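/- \begin{theorem} For smooth Riemannian manifolds $(M,g)$, $(N,h)$ with $M$ compact, and a smooth map $\phi:M\to N$ with tension field $\tau(\phi)=\operatorname{Tr}\nabla d\phi$, let $$E_2^c(\phi)=\frac12\int_M\Big(|\tau(\phi)|^2+\tfrac23\operatorname{Scal}\,|d\phi|^2-2\operatorname{Tr}\langle d\phi(\operatorname{Ric}(\cdot)),d\phi(\cdot)\rangle\Big)\,v_g$$ be its conformal-bienergy, where $\operatorname{Ric}$ and $\operatorname{Scal}$ are the Ricci and scalar curvature of $g$ (the Ricci curvature being positive on round spheres of dimension at least two). Let $m\ge 5$ and let $\mathbb S^m\subset\mathbb R^{m+1}$ be the unit sphere with its round metric. Then: (i) For every $\varepsilon>0$ there is a smooth map $\phi:\mathbb S^m\to\mathbb S^m$, homotopic to the identity map of $\mathbb S^m$, with $E_2^c(\phi)<\varepsilon$. (ii) Use polar coordinates $(\theta,r)\in\mathbb S^{m-1}\times(0,\pi)\mapsto(\sin r\cdot\theta,\cos r)$ on $\mathbb S^m$ minus the two poles. For every $t>0$ there is a (necessarily unique) smooth map $\phi_t:\mathbb S^m\to\mathbb S^m$ with $$\phi_t(\theta,r)=(\theta,\alpha_t(r)),\qquad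 \alpha_t(r)=2\arctan\big(t\tan(r/2)\big),\qquad \theta\in\mathbb S^{m-1},\ 0<r<\pi.$$ It is conformal (the pull-back of the round metric is a positive function times the round metric), it is homotopic to the identity, and $$E_2^c(\phi_t)=\frac12\,\omega_{m-1}\int_0^\pi\sin^2(\alpha_t(r))\Big((m-2)^2\sin^{m-5}r\,\big(\cos\alpha_t(r)-\cos r\big)^2+\tfrac23m(m-1)(m-3)\sin^{m-3}r\Big)\,dr,$$ where $\omega_{m-1}$ is the volume of the Euclidean unit sphere $\mathbb S^{m-1}$. Moreover $E_2^c(\phi_t)\to0$ as $t\to0^+$. \end{theorem} -/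

import Mathlib

open scoped Manifold ContDiff Topology

noncomputable section

namespace CBienergy

open MeasureTheory Bundle

/-- The Euclidean space `ℝ^m`. -/
abbrev Eucl (m : ℕ) : Type := EuclideanSpace ℝ (Fin m)

/-- The `i`-th partial derivative of a function on (an open subset of) `ℝ^m`. -/
def partialD {m : ℕ} (i : Fin m) (f : Eucl m → ℝ) (y : Eucl m) : ℝ :=
  fderiv ℝ f y (EuclideanSpace.single i 1)

/-- A smooth Riemannian metric on a manifold `M` modelled on `ℝ^m`. -/
abbrev RiemMetric (m : ℕ) (M : Type*) [TopologicalSpace M] [ChartedSpace (Eucl m) M]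
    [IsManifold (𝓡 m) ∞ M] : Type _ :=
  ContMDiffRiemannianMetric (𝓡 m) ∞ (Eucl m) (fun x : M ↦ TangentSpace (𝓡 m) x)

section OneManifold

variable {m : ℕ} {M : Type*} [TopologicalSpace M] [ChartedSpace (Eucl m) M]
  [IsManifold (𝓡 m) ∞ M]

/-- The coordinate vector field `∂_i` of the chart centred at `x`, at the point of `M` with
coordinates `y`. -/
def coordVec (x : M) (i : Fin m) (y : Eucl m) :
    TangentSpace (𝓡 m) ((chartAt (Eucl m) x).symm y) :=
  mfderiv (𝓡 m) (𝓡 m) (chartAt (Eucl m) x).symm y (EuclideanSpace.single i 1 : Eucl m)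

/-- The matrix `(g_ij)` of the metric in the chart centred at `x`. -/
def gram (g : RiemMetric m M) (x : M) (y : Eucl m) : Matrix (Fin m) (Fin m) ℝ :=
  Matrix.of fun i j ↦
    g.inner ((chartAt (Eucl m) x).symm y) (coordVec x i y) (coordVec x j y)

/-- The inverse matrix `(g^ij)` of the metric in the chart centred at `x`. -/
def gramInv (g : RiemMetric m M) (x : M) (y : Eucl m) : Matrix (Fin m) (Fin m) ℝ :=
  (gram g x y)⁻¹

/-- The Christoffel symbols of the Levi-Civita connection in the chart centred at `x`:
`∇_{∂_i} ∂_j = ∑ k, Γ^k_ij ∂_k`. -/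
def christoffel (g : RiemMetric m M) (x : M) (k i j : Fin m) (y : Eucl m) : ℝ :=
  (1 / 2) * ∑ l, gramInv g x y k l *
    (partialD i (fun z ↦ gram g x z j l) y + partialD j (fun z ↦ gram g x z i l) y
      - partialD l (fun z ↦ gram g x z i j) y)

/-- The components of the curvature tensor `R(X,Y)Z = [∇_X,∇_Y]Z - ∇_{[X,Y]}Z` in the chart
centred at `x`: `R(∂_i,∂_j)∂_k = ∑ l, (curvature g x l i j k) ∂_l`. -/
def curvature (g : RiemMetric m M) (x : M) (l i j k : Fin m) (y : Eucl m) : ℝ :=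
  partialD i (christoffel g x l j k) y - partialD j (christoffel g x l i k) y
    + ∑ s, (christoffel g x l i s y * christoffel g x s j k y
      - christoffel g x l j s y * christoffel g x s i k y)

/-- The Ricci tensor `Ric(∂_j,∂_k) = Tr {Z ↦ R(Z,∂_j)∂_k}` in the chart centred at `x`. -/
def ricci (g : RiemMetric m M) (x : M) (j k : Fin m) (y : Eucl m) : ℝ :=
  ∑ i, curvature g x i i j k y

/-- The scalar curvature at `x`. -/
def scalarCurvature (g : RiemMetric m M) (x : M) : ℝ :=
  let y := chartAt (Eucl m) x x
  ∑ j, ∑ k, gramInv g x y j k * ricci g x j k y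

/-- The components of the Ricci endomorphism at `x`: `Ric(∂_i) = ∑ j, (ricciEndo g x j i) ∂_j`. -/
def ricciEndo (g : RiemMetric m M) (x : M) (j i : Fin m) : ℝ :=
  let y := chartAt (Eucl m) x x
  ∑ l, gramInv g x y j l * ricci g x l i y

/-- The measure `√(det g) dy` on the domain of the chart centred at `x`. -/
def chartVolume [MeasurableSpace M] (g : RiemMetric m M) (x : M) : Measure M :=
  (((volume : Measure (Eucl m)).restrict (chartAt (Eucl m) x).target).withDensity
    (fun y ↦ ENNReal.ofReal (Real.sqrt (gram g x y).det))).map (chartAt (Eucl m) x).symm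

/-- The Riemannian volume measure `v_g`. The measures `√(det g) dy` of two charts agree on the
intersection of the chart domains; the measure on `M` that restricts to each of them on its chart
domain is their least upper bound in the lattice of measures. -/
def volumeMeasure [MeasurableSpace M] (g : RiemMetric m M) : Measure M :=
  ⨆ x : M, chartVolume g x

end OneManifold

section Maps

variable {m n : ℕ} {M N : Type*}
  [TopologicalSpace M] [ChartedSpace (Eucl m) M] [IsManifold (𝓡 m) ∞ M]
  [TopologicalSpace N] [ChartedSpace (Eucl n) N] [IsManifold (𝓡 n) ∞ N]

/-- The `a`-th component `φ^a` of the map `φ`, read in the charts centred at `x` and `φ x`. -/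
def localRep (φ : M → N) (x : M) (a : Fin n) (y : Eucl m) : ℝ :=
  chartAt (Eucl n) (φ x) (φ ((chartAt (Eucl m) x).symm y)) a

/-- The inner product `⟨dφ(∂_i), dφ(∂_j)⟩` at `x`. -/
def dInner (h : RiemMetric n N) (φ : M → N) (x : M) (i j : Fin m) : ℝ :=
  let y := chartAt (Eucl m) x x
  let z := chartAt (Eucl n) (φ x) (φ x)
  ∑ a, ∑ b, gram h (φ x) z a b *
    partialD i (localRep φ x a) y * partialD j (localRep φ x b) y

/-- The squared norm `|dφ|²` at `x`. -/
def dNormSq (g : RiemMetric m M) (h : RiemMetric n N) (φ : M → N) (x : M) : ℝ :=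
  ∑ i, ∑ j, gramInv g x (chartAt (Eucl m) x x) i j * dInner h φ x i j

/-- The trace `Tr ⟨dφ(Ric(·)), dφ(·)⟩` at `x`. -/
def ricciTrace (g : RiemMetric m M) (h : RiemMetric n N) (φ : M → N) (x : M) : ℝ :=
  ∑ i, ∑ k, gramInv g x (chartAt (Eucl m) x x) i k *
    ∑ j, ricciEndo g x j i * dInner h φ x j k

/-- The components of the second fundamental form `∇dφ` at `x`:
`(∇dφ)(∂_i,∂_j) = ∑ a, (secondForm g h φ x a i j) ∂_a`. -/
def secondForm (g : RiemMetric m M) (h : RiemMetric n N) (φ : M → N) (x : M) (a : Fin n)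
    (i j : Fin m) : ℝ :=
  let y := chartAt (Eucl m) x x
  let z := chartAt (Eucl n) (φ x) (φ x)
  partialD i (partialD j (localRep φ x a)) y
    - ∑ k, christoffel g x k i j y * partialD k (localRep φ x a) y
    + ∑ b, ∑ c, christoffel h (φ x) a b c z *
        partialD i (localRep φ x b) y * partialD j (localRep φ x c) y

/-- The components of the tension field `τ(φ) = Tr ∇dφ` at `x`, in the chart centred at `φ x`. -/
def tension (g : RiemMetric m M) (h : RiemMetric n N) (φ : M → N) (x : M) (a : Fin n) : ℝ :=
  ∑ i, ∑ j, gramInv g x (chartAt (Eucl m) x x) i j * secondForm g h φ x a i j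

/-- The squared norm `|τ(φ)|²` at `x`. -/
def tensionNormSq (g : RiemMetric m M) (h : RiemMetric n N) (φ : M → N) (x : M) : ℝ :=
  ∑ a, ∑ b, gram h (φ x) (chartAt (Eucl n) (φ x) (φ x)) a b *
    tension g h φ x a * tension g h φ x b

/-- The conformal-bienergy functional
`E₂ᶜ(φ) = 1/2 ∫_M |τ(φ)|² + 2/3 Scal |dφ|² - 2 Tr ⟨dφ(Ric(·)), dφ(·)⟩ v_g`
of a smooth map `φ : (M, g) → (N, h)`, for `M` compact. -/
def cBienergy [CompactSpace M] [MeasurableSpace M] [BorelSpace M]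
    (g : RiemMetric m M) (h : RiemMetric n N) (φ : C^∞⟮𝓡 m, M; 𝓡 n, N⟯) : ℝ :=
  (1 / 2) * ∫ x, (tensionNormSq g h φ x + (2 / 3) * scalarCurvature g x * dNormSq g h φ x
    - 2 * ricciTrace g h φ x) ∂(volumeMeasure g)

/-- `φ` is conformal: `φ^* h = λ g` for a positive function `λ`. -/
def IsConformal (g : RiemMetric m M) (h : RiemMetric n N) (φ : C^∞⟮𝓡 m, M; 𝓡 n, N⟯) : Prop :=
  ∃ lam : M → ℝ, (∀ x, 0 < lam x) ∧ ∀ (x : M) (v w : TangentSpace (𝓡 m) x),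
    h.inner (φ x) (mfderiv (𝓡 m) (𝓡 n) φ x v) (mfderiv (𝓡 m) (𝓡 n) φ x w)
      = lam x * g.inner x v w

end Maps

section Sphere

/-- The unit sphere `S^m` in `ℝ^(m+1)`. -/
abbrev Sph (m : ℕ) : Type := Metric.sphere (0 : Eucl (m + 1)) 1

/-- The differential at `p` of the inclusion `S^m → ℝ^(m+1)`, on `T_p S^m = ℝ^m`. -/
def inclD (m : ℕ) (p : Sph m) : Eucl m →L[ℝ] Eucl (m + 1) :=
  mfderiv (𝓡 m) 𝓘(ℝ, Eucl (m + 1)) (Subtype.val : Sph m → Eucl (m + 1)) p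

theorem inclD_injective (m : ℕ) (p : Sph m) : Function.Injective (inclD m p) := by
  have := Fact.mk (@finrank_euclideanSpace_fin ℝ _ (m + 1))
  exact injective_mvfderiv_subtypeVal_sphere p

theorem inclD_isVonNBounded (m : ℕ) (p : Sph m) :
    Bornology.IsVonNBounded ℝ {v : Eucl m | inner ℝ (inclD m p v) (inclD m p v) < 1} := by
  obtain ⟨K, -, hK⟩ := (inclD m p : Eucl m →ₗ[ℝ] Eucl (m + 1)).exists_antilipschitzWith
    (LinearMap.ker_eq_bot.2 (inclD_injective m p))
  rw [NormedSpace.isVonNBounded_iff]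
  refine (hK.isBounded_preimage (Metric.isBounded_ball (x := (0 : Eucl (m + 1))) (r := 1))).subset ?_
  intro v hv
  have hv' : inner ℝ (inclD m p v) (inclD m p v) < 1 := hv
  rw [real_inner_self_eq_norm_sq] at hv'
  have : ‖inclD m p v‖ < 1 := by nlinarith [norm_nonneg (inclD m p v)]
  simpa using this

/-- The bilinear form `(v, w) ↦ ⟨A v, A w⟩`. -/
def pullInner {m n : ℕ} (A : Eucl m →L[ℝ] Eucl n) : Eucl m →L[ℝ] Eucl m →L[ℝ] ℝ :=
  (innerSL ℝ (E := Eucl n)).bilinearComp A A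

theorem pullInner_apply {m n : ℕ} (A : Eucl m →L[ℝ] Eucl n) (v w : Eucl m) :
    pullInner A v w = inner ℝ (A v) (A w) := rfl

theorem contDiff_pullInner {m n : ℕ} :
    ContDiff ℝ ∞ (pullInner : (Eucl m →L[ℝ] Eucl n) → (Eucl m →L[ℝ] Eucl m →L[ℝ] ℝ)) := by
  have h : (pullInner : (Eucl m →L[ℝ] Eucl n) → (Eucl m →L[ℝ] Eucl m →L[ℝ] ℝ)) = fun A ↦
      ((ContinuousLinearMap.compL ℝ (Eucl m) (Eucl n) ℝ).flip A).comp
        ((innerSL ℝ (E := Eucl n)).comp A) := by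
    ext A v w
    rfl
  rw [h]
  exact (ContinuousLinearMap.contDiff _).clm_comp (contDiff_const.clm_comp contDiff_id)

/-- The inner product `⟨dι(v), dι(w)⟩` on `T_p S^m`, where `ι : S^m → ℝ^(m+1)` is the inclusion. -/
def roundInner (m : ℕ) (p : Sph m) :
    TangentSpace (𝓡 m) p →L[ℝ] TangentSpace (𝓡 m) p →L[ℝ] ℝ :=
  pullInner (inclD m p)

theorem contMDiff_roundInner (m : ℕ) :
    ContMDiff (𝓡 m) ((𝓡 m).prod 𝓘(ℝ, Eucl m →L[ℝ] Eucl m →L[ℝ] ℝ)) ∞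
      (fun p : Sph m ↦ TotalSpace.mk' (Eucl m →L[ℝ] Eucl m →L[ℝ] ℝ)
        (E := fun p : Sph m ↦ TangentSpace (𝓡 m) p →L[ℝ] TangentSpace (𝓡 m) p →L[ℝ] ℝ)
        p (roundInner m p)) := by
  intro x
  have := Fact.mk (@finrank_euclideanSpace_fin ℝ _ (m + 1))
  have h1 : ContMDiffAt (𝓡 m) 𝓘(ℝ, Eucl (m + 1)) ∞ (Subtype.val : Sph m → Eucl (m + 1)) x :=
    contMDiff_coe_sphere x
  have h2 := h1.mfderiv_const (m := ∞) le_rfl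
  have h3 := (contDiff_pullInner (m := m) (n := m + 1)).contMDiff.contMDiffAt.comp x h2
  rw [contMDiffAt_section]
  refine h3.congr_of_eventuallyEq ?_
  filter_upwards [(trivializationAt (Eucl m) (TangentSpace (𝓡 m)) x).open_baseSet.mem_nhds
    (mem_baseSet_trivializationAt (Eucl m) (TangentSpace (𝓡 m)) x)] with y hy
  ext v w
  rw [hom_trivializationAt_apply]
  have e1 := _root_.inCoordinates_apply_eq₂ (F₃ := ℝ) (E₃ := fun _ : Sph m ↦ ℝ)
    (x₀ := x) (x := y) (ϕ := roundInner m y) (v := v) (w := w) hy hy (Set.mem_univ _)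
  refine e1.trans ?_
  have e2 : inTangentCoordinates (𝓡 m) 𝓘(ℝ, Eucl (m + 1)) id Subtype.val
      (fun p : Sph m ↦ inclD m p) x y = ContinuousLinearMap.comp (inclD m y)
        ((trivializationAt (Eucl m) (TangentSpace (𝓡 m)) x).symmL ℝ y) := by
    ext u
    simp [inTangentCoordinates, ContinuousLinearMap.inCoordinates]
    rfl
  change _ = pullInner (inTangentCoordinates (𝓡 m) 𝓘(ℝ, Eucl (m + 1)) id Subtype.val
      (fun p : Sph m ↦ inclD m p) x y) v w
  have e3 (u : Eucl m) : (trivializationAt (Eucl m) (TangentSpace (𝓡 m)) x).symm y u =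
      (trivializationAt (Eucl m) (TangentSpace (𝓡 m)) x).symmL ℝ y u :=
    (Bundle.Trivialization.symmL_apply _ hy _).symm
  rw [e2]
  simp
  rw [e3, e3]
  rfl

/-- The round metric of `S^m`, induced by the inclusion in the Euclidean space `ℝ^(m+1)`. -/
def roundMetric (m : ℕ) : RiemMetric m (Sph m) where
  inner p := roundInner m p
  symm p v w := real_inner_comm (inclD m p w) (inclD m p v)
  pos p _ hv := real_inner_self_pos.2 fun h ↦
    hv (inclD_injective m p (h.trans (map_zero (inclD m p)).symm))
  isVonNBounded p := inclD_isVonNBounded m p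
  contMDiff := contMDiff_roundInner m

/-- The point of `S^m` with polar coordinates `(θ, r)` around the north pole, where
`θ ∈ S^(m-1)`: the point `(sin r · θ, cos r)` of `ℝ^m × ℝ`. -/
def polar {m : ℕ} (θ : Metric.sphere (0 : Eucl m) 1) (r : ℝ) : Sph m :=
  ⟨WithLp.toLp 2 (Fin.snoc (fun i ↦ Real.sin r * (θ : Eucl m) i) (Real.cos r) : Fin (m + 1) → ℝ), by
    have h : ∑ i, (θ : Eucl m) i ^ 2 = 1 := by
      rw [← EuclideanSpace.real_norm_sq_eq, norm_eq_of_mem_sphere θ, one_pow]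
    rw [mem_sphere_zero_iff_norm, EuclideanSpace.norm_eq, Real.sqrt_eq_one, Fin.sum_univ_castSucc]
    simp [mul_pow, ← Finset.mul_sum, h]⟩

/-- The radial profile `α_t(r) = 2 arctan (t tan (r/2))`. -/
def profile (t r : ℝ) : ℝ := 2 * Real.arctan (t * Real.tan (r / 2))

/-- The volume `ω_{m-1}` of the Euclidean unit sphere `S^(m-1)` in `ℝ^m`. -/
def sphereVolume (m : ℕ) : ℝ := ((volume : Measure (Eucl m)).toSphere).real Set.univ

end Sphere

end CBienergy

end

noncomputable section

namespace CBienergy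

open MeasureTheory Bundle

/-! The maps are the conformal dilations of the sphere fixing both poles: stereographic projection
turns them into multiplication by `t`. In ambient coordinates the dilation is `N(x) / D(x)`, with
`N` and `D` affine in `x` (`dilNum`, `dilDen`) and `|N|² = D²` on the sphere. It is therefore
smooth, joins the identity as `t` moves to `1`, and is conformal with factor `λ² = (2t / D)²`.

The energy density at `p` is defined through the charts centred at `p` and at its image `q`. These
are stereographic charts, with metric `16 / (|y|² + 4)²` times the Euclidean one, so at the centre
the metric is the identity and the Christoffel symbols vanish. The tension field reduces to the flat
Laplacian of the local representation, which only needs pure second derivatives along coordinate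
axes; on an axis the local representation is a quotient of quadratics (`localRep_dilation_line`).
Summing over the frame (`sum_inner_frame`) gives `(m - 2)(1 - t²) / D` times the tangential part of
the north pole at `q` (`tension_dilation`). Since `Ric = m - 1` and `Scal = m(m - 1)`, the curvature
terms add up to `(2/3) m (m - 1)(m - 3) λ²`.

The density thus depends on the height alone. All chart measures coincide, so the volume is computed
in the single chart at the north pole, by polar coordinates in `ℝ^m` and `ρ = 2 tan (r/2)`
(`integral_height`). The stated form of the integrand then follows from `cos α - cos r = (1 - t²)
sin² r / D` and `sin α = 2t sin r / D`.

As `t → 0⁺` the factor `sin² α` tends to zero pointwise while the integrand stays bounded, so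
dominated convergence sends the energy to zero. The first claim follows by taking `t` small. -/

instance factFinrankEucl (m : ℕ) : Fact (Module.finrank ℝ (Eucl (m + 1)) = m + 1) :=
  ⟨finrank_euclideanSpace_fin⟩

/-- The isometry of `ℝ^m` onto the tangent hyperplane `p^⊥` underlying the chart centred at `p`. -/
def frame {m : ℕ} (p : Sph m) : Eucl m →ₗᵢ[ℝ] Eucl (m + 1) :=
  (Submodule.subtypeₗᵢ (ℝ ∙ ((-p : Sph m) : Eucl (m + 1)))ᗮ).comp
    (OrthonormalBasis.fromOrthogonalSpanSingleton m
      (ne_zero_of_mem_unit_sphere (-p))).repr.symm.toLinearIsometry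

/-! ### Stereographic charts centred at an arbitrary point of the sphere -/

section Frame

variable {m : ℕ} (p : Sph m)

theorem inner_self_sphere : inner ℝ (p : Eucl (m + 1)) p = 1 := by
  rw [real_inner_self_eq_norm_sq, norm_eq_of_mem_sphere p, one_pow]

theorem inner_frame (y : Eucl m) : inner ℝ (p : Eucl (m + 1)) (frame p y) = 0 := by
  have h := ((OrthonormalBasis.fromOrthogonalSpanSingleton m
      (ne_zero_of_mem_unit_sphere (-p))).repr.symm y).2
  rw [Submodule.mem_orthogonal_singleton_iff_inner_right] at h
  have h' : inner ℝ (-(p : Eucl (m + 1))) (frame p y) = 0 := h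
  rwa [inner_neg_left, neg_eq_zero] at h'

theorem inner_frame_left (y : Eucl m) : inner ℝ (frame p y) (p : Eucl (m + 1)) = 0 := by
  rw [real_inner_comm, inner_frame]

theorem exists_frame_eq {w : Eucl (m + 1)} (hw : inner ℝ (p : Eucl (m + 1)) w = 0) :
    ∃ y, frame p y = w := by
  have hw' : w ∈ (ℝ ∙ ((-p : Sph m) : Eucl (m + 1)))ᗮ := by
    rw [Submodule.mem_orthogonal_singleton_iff_inner_right]
    change inner ℝ (-(p : Eucl (m + 1))) w = 0
    rw [inner_neg_left, hw, neg_zero]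
  refine ⟨(OrthonormalBasis.fromOrthogonalSpanSingleton m
      (ne_zero_of_mem_unit_sphere (-p))).repr ⟨w, hw'⟩, ?_⟩
  exact congrArg Subtype.val (LinearIsometryEquiv.symm_apply_apply _ _)

/-- Parseval's identity: the frame at `p` together with `p` is an orthonormal basis of the ambient
space. It turns the traces over tangent frames below into closed expressions in ambient inner
products. -/
theorem sum_inner_frame (v w : Eucl (m + 1)) :
    ∑ i, inner ℝ (frame p (EuclideanSpace.single i 1)) v *
      inner ℝ (frame p (EuclideanSpace.single i 1)) w =
      inner ℝ v w - inner ℝ (p : Eucl (m + 1)) v * inner ℝ (p : Eucl (m + 1)) w := by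
  have key (v : Eucl (m + 1)) : ∃ y, frame p y = v - inner ℝ (p : Eucl (m + 1)) v • p :=
    exists_frame_eq p (by rw [inner_sub_right, inner_smul_right, inner_self_sphere]; ring)
  obtain ⟨y, hy⟩ := key v
  obtain ⟨z, hz⟩ := key w
  have hy' : v = frame p y + inner ℝ (p : Eucl (m + 1)) v • p := by rw [hy]; abel
  have hz' : w = frame p z + inner ℝ (p : Eucl (m + 1)) w • p := by rw [hz]; abel
  have e1 : inner ℝ v w = inner ℝ y z +
      inner ℝ (p : Eucl (m + 1)) v * inner ℝ (p : Eucl (m + 1)) w := by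
    conv_lhs => rw [hy', hz']
    simp only [inner_add_left, inner_add_right, inner_smul_left, inner_smul_right, inner_frame,
      inner_frame_left, inner_self_sphere, LinearIsometry.inner_map_map]
    simp [mul_comm]
  have e2 (i : Fin m) : inner ℝ (frame p (EuclideanSpace.single i 1)) v = y i := by
    rw [hy', inner_add_right, inner_smul_right, inner_frame_left, LinearIsometry.inner_map_map,
      EuclideanSpace.inner_single_left]
    simp
  have e3 (i : Fin m) : inner ℝ (frame p (EuclideanSpace.single i 1)) w = z i := by
    rw [hz', inner_add_right, inner_smul_right, inner_frame_left, LinearIsometry.inner_map_map,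
      EuclideanSpace.inner_single_left]
    simp
  rw [e1]
  simp only [e2, e3]
  rw [PiLp.inner_apply]
  simp [mul_comm]

/-- The inverse stereographic projection underlying the chart centred at `p`. -/
def param (y : Eucl m) : Eucl (m + 1) :=
  (‖y‖ ^ 2 + 4)⁻¹ • ((4 : ℝ) • frame p y + (4 - ‖y‖ ^ 2) • (p : Eucl (m + 1)))

theorem coe_chartAt_symm (y : Eucl m) :
    ((chartAt (Eucl m) p).symm y : Eucl (m + 1)) = param p y := by
  have h := stereographic'_symm_apply (n := m) (-p) y
  refine h.trans ?_
  have hn : ‖frame p y‖ = ‖y‖ := (frame p).norm_map y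
  change (‖frame p y‖ ^ 2 + 4)⁻¹ • (4 : ℝ) • frame p y +
    (‖frame p y‖ ^ 2 + 4)⁻¹ • (‖frame p y‖ ^ 2 - 4) • (-(p : Eucl (m + 1))) = _
  rw [hn, param]
  module

/-- The orthogonal projection inside the stereographic map is self-adjoint and fixes the hyperplane,
so it disappears from the inner product. This makes the coordinates explicit rational functions of
the ambient point. -/
theorem inner_chartAt (z : Sph m) (y : Eucl m) :
    inner ℝ (chartAt (Eucl m) p z) y =
      2 / (1 + inner ℝ (p : Eucl (m + 1)) z) * inner ℝ (frame p y) (z : Eucl (m + 1)) := by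
  change inner ℝ ((OrthonormalBasis.fromOrthogonalSpanSingleton m
      (ne_zero_of_mem_unit_sphere (-p))).repr
        (stereographic (norm_eq_of_mem_sphere (-p)) z)) y = _
  rw [← LinearIsometryEquiv.inner_map_map (OrthonormalBasis.fromOrthogonalSpanSingleton m
      (ne_zero_of_mem_unit_sphere (-p))).repr.symm, LinearIsometryEquiv.symm_apply_apply,
      stereographic_apply, inner_smul_left, Submodule.coe_inner,
      ← Submodule.starProjection_apply, Submodule.inner_starProjection_left_eq_right,
      Submodule.starProjection_apply]
  simp only [Submodule.orthogonalProjectionOnto_mem_subspace_eq_self]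
  change 2 / (1 - inner ℝ (-(p : Eucl (m + 1))) (z : Eucl (m + 1))) *
    inner ℝ (z : Eucl (m + 1)) (frame p y) = _
  rw [inner_neg_left, sub_neg_eq_add, real_inner_comm (frame p y)]

theorem chartAt_apply (z : Sph m) (a : Fin m) :
    chartAt (Eucl m) p z a = 2 / (1 + inner ℝ (p : Eucl (m + 1)) z) *
      inner ℝ (frame p (EuclideanSpace.single a 1)) (z : Eucl (m + 1)) := by
  rw [← inner_chartAt, EuclideanSpace.inner_single_right]
  simp

theorem chartAt_self : chartAt (Eucl m) p p = 0 := by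
  ext a
  rw [chartAt_apply, inner_frame_left]
  simp

theorem chartAt_target : (chartAt (Eucl m) p).target = Set.univ :=
  stereographic'_target (n := m) (-p)

theorem chartAt_source : (chartAt (Eucl m) p).source = {-p}ᶜ :=
  stereographic'_source (n := m) (-p)

theorem param_zero : param p 0 = p := by
  simp [param]

theorem norm_param (y : Eucl m) : ‖param p y‖ = 1 := by
  rw [← coe_chartAt_symm]
  exact norm_eq_of_mem_sphere _

theorem contDiff_param : ContDiff ℝ ∞ (param p) := by
  have h := contDiff_norm_sq ℝ (E := Eucl m) (n := ∞)
  have h' : ContDiff ℝ ∞ (frame p) := (frame p).toContinuousLinearMap.contDiff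
  have h4 (y : Eucl m) : ‖y‖ ^ 2 + 4 ≠ 0 := by positivity
  exact ((h.add contDiff_const).inv h4).smul
    ((h'.const_smul (4 : ℝ)).add ((contDiff_const.sub h).smul contDiff_const))

theorem fderiv_param_apply (y v : Eucl m) :
    fderiv ℝ (param p) y v = (4 / (‖y‖ ^ 2 + 4)) • frame p v -
      (2 * inner ℝ y v / (‖y‖ ^ 2 + 4) ^ 2) •
        ((4 : ℝ) • frame p y + (8 : ℝ) • (p : Eucl (m + 1))) := by
  have h4 : ‖y‖ ^ 2 + 4 ≠ 0 := by positivity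
  have h1 : HasFDerivAt (fun y : Eucl m ↦ ‖y‖ ^ 2) (2 • innerSL ℝ y) y :=
    (hasStrictFDerivAt_norm_sq y).hasFDerivAt
  have h2 := (hasDerivAt_inv h4).comp_hasFDerivAt y (h1.add_const 4)
  have h3 := (((frame p).toContinuousLinearMap.hasFDerivAt (x := y)).const_smul (4 : ℝ)).add
    ((h1.const_sub 4).smul_const (p : Eucl (m + 1)))
  have h5 := (h2.smul h3).fderiv
  have h6 : fderiv ℝ (param p) y = _ := h5
  rw [h6]
  simp
  match_scalars <;> (field_simp; try ring)

/-- Conformality of stereographic projection: the source both of the metric in the charts and of the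
Jacobians of the transition maps. -/
theorem inner_fderiv_param (y v w : Eucl m) :
    inner ℝ (fderiv ℝ (param p) y v) (fderiv ℝ (param p) y w) =
      16 / (‖y‖ ^ 2 + 4) ^ 2 * inner ℝ v w := by
  have h4 : ‖y‖ ^ 2 + 4 ≠ 0 := by positivity
  rw [fderiv_param_apply, fderiv_param_apply]
  simp only [inner_add_left, inner_add_right, inner_sub_left, inner_sub_right, inner_smul_left,
    inner_smul_right, inner_frame, inner_frame_left,
    LinearIsometry.inner_map_map, real_inner_self_eq_norm_sq, real_inner_comm y v]
  simp
  field_simp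
  ring

/-- The chain rule applied to inclusion after inverse chart, which is `param p`; it replaces
manifold derivatives by derivatives of an explicit map of vector spaces. -/
theorem inclD_mfderiv_chartAt_symm (y : Eucl m) (v : Eucl m) :
    inclD m ((chartAt (Eucl m) p).symm y)
      (mfderiv (𝓡 m) (𝓡 m) (chartAt (Eucl m) p).symm y v) = fderiv ℝ (param p) y v := by
  have h1 : MDifferentiableAt (𝓡 m) (𝓡 m) (chartAt (Eucl m) p).symm y := by
    have := contMDiffOn_chart_symm (I := 𝓡 m) (n := ∞) (x := p)
    exact ((this y (by rw [chartAt_target]; trivial)).contMDiffAt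
      (by rw [chartAt_target]; exact Filter.univ_mem)).mdifferentiableAt (by simp)
  have h2 : MDifferentiableAt (𝓡 m) 𝓘(ℝ, Eucl (m + 1)) (Subtype.val : Sph m → Eucl (m + 1))
      ((chartAt (Eucl m) p).symm y) :=
    (contMDiff_coe_sphere (m := ∞) _).mdifferentiableAt (by simp)
  have h3 := mfderiv_comp y h2 h1
  have h4 : (Subtype.val : Sph m → Eucl (m + 1)) ∘ (chartAt (Eucl m) p).symm = param p :=
    funext (coe_chartAt_symm p)
  rw [h4, mfderiv_eq_fderiv] at h3
  rw [h3]
  rfl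

theorem gram_roundMetric (y : Eucl m) :
    gram (roundMetric m) p y = (16 / (‖y‖ ^ 2 + 4) ^ 2) • (1 : Matrix (Fin m) (Fin m) ℝ) := by
  ext i j
  have : gram (roundMetric m) p y i j = inner ℝ
      (inclD m ((chartAt (Eucl m) p).symm y) (mfderiv (𝓡 m) (𝓡 m) (chartAt (Eucl m) p).symm y
        (EuclideanSpace.single i 1 : Eucl m)))
      (inclD m ((chartAt (Eucl m) p).symm y) (mfderiv (𝓡 m) (𝓡 m) (chartAt (Eucl m) p).symm y
        (EuclideanSpace.single j 1 : Eucl m))) := rfl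
  rw [this, inclD_mfderiv_chartAt_symm, inclD_mfderiv_chartAt_symm, inner_fderiv_param]
  simp [Matrix.one_apply, EuclideanSpace.inner_single_left]

end Frame

/-! ### Christoffel symbols and curvature of the round metric -/

section Curvature

variable {m : ℕ} (p : Sph m)

theorem gramInv_roundMetric (y : Eucl m) :
    gramInv (roundMetric m) p y = ((‖y‖ ^ 2 + 4) ^ 2 / 16) • (1 : Matrix (Fin m) (Fin m) ℝ) := by
  have h4 : ‖y‖ ^ 2 + 4 ≠ 0 := by positivity
  rw [gramInv, gram_roundMetric]
  refine Matrix.inv_eq_right_inv ?_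
  rw [smul_mul_smul_comm, mul_one]
  convert one_smul ℝ (1 : Matrix (Fin m) (Fin m) ℝ) using 2
  field_simp

theorem gramInv_roundMetric_center (i j : Fin m) :
    gramInv (roundMetric m) p (chartAt (Eucl m) p p) i j = if i = j then 1 else 0 := by
  rw [chartAt_self, gramInv_roundMetric]
  norm_num [Matrix.one_apply]

theorem gram_roundMetric_center (i j : Fin m) :
    gram (roundMetric m) p (chartAt (Eucl m) p p) i j = if i = j then 1 else 0 := by
  rw [chartAt_self, gram_roundMetric]
  norm_num [Matrix.one_apply]

theorem partialD_gram_roundMetric (i j k : Fin m) (y : Eucl m) :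
    partialD i (fun z ↦ gram (roundMetric m) p z j k) y =
      if j = k then -(64 * y i / (‖y‖ ^ 2 + 4) ^ 3) else 0 := by
  have h4 : ‖y‖ ^ 2 + 4 ≠ 0 := by positivity
  have e : (fun z ↦ gram (roundMetric m) p z j k) =
      fun z ↦ 16 * (if j = k then 1 else 0) * ((‖z‖ ^ 2 + 4) ^ 2)⁻¹ := by
    ext z
    rw [gram_roundMetric]
    simp only [Matrix.smul_apply, Matrix.one_apply, smul_eq_mul]
    ring
  have h1 : HasFDerivAt (fun y : Eucl m ↦ ‖y‖ ^ 2) (2 • innerSL ℝ y) y :=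
    (hasStrictFDerivAt_norm_sq y).hasFDerivAt
  have h2 := ((hasDerivAt_inv (pow_ne_zero 2 h4)).comp_hasFDerivAt y
    ((h1.add_const 4).pow 2)).const_mul (16 * (if j = k then (1 : ℝ) else 0))
  rw [e, partialD]
  have h3 : fderiv ℝ (fun z : Eucl m ↦ 16 * (if j = k then (1 : ℝ) else 0) *
    ((‖z‖ ^ 2 + 4) ^ 2)⁻¹) y = _ := h2.fderiv
  rw [h3]
  split_ifs
  · simp [EuclideanSpace.inner_single_right]
    field_simp
    ring
  · simp

/-- The formula for a conformally flat metric `e^(2u) δ`, with `∂_i u = -2 y_i / (|y|² + 4)`. -/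
theorem christoffel_roundMetric (k i j : Fin m) (y : Eucl m) :
    christoffel (roundMetric m) p k i j y =
      2 / (‖y‖ ^ 2 + 4) * ((if i = j then y k else 0) - (if j = k then y i else 0)
        - (if i = k then y j else 0)) := by
  have h4 : ‖y‖ ^ 2 + 4 ≠ 0 := by positivity
  simp only [christoffel, partialD_gram_roundMetric, gramInv_roundMetric, Matrix.smul_apply,
    Matrix.one_apply, smul_eq_mul]
  rw [Finset.sum_eq_single k (fun l _ hl ↦ by simp [Ne.symm hl]) (by simp)]
  simp only [if_true]
  split_ifs <;> (field_simp; ring_nf)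

theorem christoffel_roundMetric_center (k i j : Fin m) :
    christoffel (roundMetric m) p k i j 0 = 0 := by
  simp [christoffel_roundMetric]

theorem partialD_christoffel_roundMetric (l k i j : Fin m) :
    partialD l (christoffel (roundMetric m) p k i j) 0 =
      1 / 2 * ((if i = j ∧ l = k then 1 else 0) - (if j = k ∧ l = i then 1 else 0)
        - (if i = k ∧ l = j then 1 else 0)) := by
  let f : Eucl m →L[ℝ] ℝ := (if i = j then EuclideanSpace.proj k else 0)
    - (if j = k then EuclideanSpace.proj i else 0) - (if i = k then EuclideanSpace.proj j else 0)
  -- The linear factor `f` vanishes at the origin, so only its derivative survives, times the value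
  -- `1/2` of the other factor.
  have e : christoffel (roundMetric m) p k i j = fun y ↦ (2 * (‖y‖ ^ 2 + 4)⁻¹) * f y := by
    ext y
    rw [christoffel_roundMetric]
    simp only [f, div_eq_mul_inv]
    split_ifs <;> simp
  have h4 : ‖(0 : Eucl m)‖ ^ 2 + 4 ≠ 0 := by positivity
  have h1 : HasFDerivAt (fun y : Eucl m ↦ ‖y‖ ^ 2) (2 • innerSL ℝ (0 : Eucl m)) 0 :=
    (hasStrictFDerivAt_norm_sq 0).hasFDerivAt
  have h2 := (((hasDerivAt_inv h4).comp_hasFDerivAt (0 : Eucl m) (h1.add_const 4)).const_mul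
    (2 : ℝ)).mul (f.hasFDerivAt (x := 0))
  rw [e, partialD]
  have h3 : fderiv ℝ (fun y : Eucl m ↦ (2 * (‖y‖ ^ 2 + 4)⁻¹) * f y) 0 = _ := h2.fderiv
  rw [h3]
  simp only [f]
  simp [ite_and, apply_ite (fun g : Eucl m →L[ℝ] ℝ ↦ g (EuclideanSpace.single l (1 : ℝ))),
    eq_comm]
  norm_num

/-- The quadratic terms vanish at the centre, leaving the curvature tensor of constant curvature
one; with this sign convention its trace is the positive Ricci tensor `(m - 1) g`. -/
theorem curvature_roundMetric_center (l i j k : Fin m) :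
    curvature (roundMetric m) p l i j k 0 =
      (if j = k ∧ i = l then 1 else 0) - (if i = k ∧ j = l then 1 else 0) := by
  simp only [curvature, partialD_christoffel_roundMetric, christoffel_roundMetric_center]
  simp only [mul_zero, sub_self, Finset.sum_const_zero, add_zero]
  have h2 : (i = l ∧ j = k) ↔ (j = k ∧ i = l) := and_comm
  have h3 : (j = l ∧ i = k) ↔ (i = k ∧ j = l) := and_comm
  have h4 : (k = l ∧ i = j) ↔ (k = l ∧ j = i) := by rw [eq_comm (a := i)]
  simp only [h2, h3, h4]
  ring

theorem ricci_roundMetric_center (j k : Fin m) :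
    ricci (roundMetric m) p j k 0 = if j = k then (m : ℝ) - 1 else 0 := by
  simp only [ricci, curvature_roundMetric_center, Finset.sum_sub_distrib, and_true]
  by_cases h : j = k
  · subst h
    have (x : Fin m) : (x = j ∧ j = x) ↔ x = j := by rw [eq_comm (a := j)]; simp
    simp [this]
  · have (x : Fin m) : ¬ (x = k ∧ j = x) := fun hx ↦ h (hx.2.trans hx.1)
    simp [h, this]

theorem scalarCurvature_roundMetric :
    scalarCurvature (roundMetric m) p = (m : ℝ) * ((m : ℝ) - 1) := by
  simp only [scalarCurvature, gramInv_roundMetric_center]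
  rw [chartAt_self]
  simp [ricci_roundMetric_center, mul_sub]

theorem ricciEndo_roundMetric (j i : Fin m) :
    ricciEndo (roundMetric m) p j i = if j = i then (m : ℝ) - 1 else 0 := by
  simp only [ricciEndo, gramInv_roundMetric_center]
  rw [chartAt_self]
  simp [ricci_roundMetric_center]

end Curvature

/-- The north pole of `S^m`. -/
def north (m : ℕ) : Sph m := ⟨EuclideanSpace.single (Fin.last m) 1, by simp⟩

/-! ### Conformal dilations in ambient coordinates -/

section Dilation

variable {m : ℕ}

/-- The height of a point over the equatorial hyperplane. -/
abbrev height (x : Eucl (m + 1)) : ℝ := inner ℝ (north m : Eucl (m + 1)) x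

theorem height_eq (x : Eucl (m + 1)) : height x = x (Fin.last m) := by
  simp [height, north, EuclideanSpace.inner_single_left]

theorem height_sq_le {x : Eucl (m + 1)} (hx : inner ℝ x x = 1) : height x ^ 2 ≤ 1 := by
  have h := real_inner_mul_inner_self_le (north m : Eucl (m + 1)) x
  rw [inner_self_sphere, hx] at h
  rw [sq]
  exact h.trans_eq (by ring)

/-- The denominator of the conformal dilation. -/
def dilDen (t : ℝ) (x : Eucl (m + 1)) : ℝ := (1 + t ^ 2) + (1 - t ^ 2) * height x

/-- The numerator of the conformal dilation. -/
def dilNum (t : ℝ) (x : Eucl (m + 1)) : Eucl (m + 1) :=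
  (2 * t) • x + ((1 - t ^ 2) + (1 - t) ^ 2 * height x) • (north m : Eucl (m + 1))

/-- The map of `ℝ^(m+1)` restricting to the conformal dilation of `S^m` by the factor `t`, which
fixes both poles. -/
def dilFun (t : ℝ) (x : Eucl (m + 1)) : Eucl (m + 1) := (dilDen t x)⁻¹ • dilNum t x

theorem dilDen_pos {t : ℝ} (ht : 0 < t) {x : Eucl (m + 1)} (hx : inner ℝ x x = 1) :
    0 < dilDen t x := by
  have h := abs_le.1 ((sq_le_one_iff_abs_le_one _).1 (height_sq_le hx))
  -- Both summands are nonnegative for heights in `[-1, 1]` and they never vanish together.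
  have e : dilDen t x = (1 + height x) + t ^ 2 * (1 - height x) := by
    rw [dilDen]
    ring
  rw [e]
  rcases h.1.eq_or_lt with h1 | h1
  · rw [← h1]
    ring_nf
    positivity
  · have : 0 ≤ t ^ 2 * (1 - height x) := mul_nonneg (sq_nonneg t) (by linarith [h.2])
    linarith

/-- This is why `dilFun` preserves the sphere. Differentiated along a tangent vector, it also
explains `inner_dil_tangent`. -/
theorem inner_dilNum_self (t : ℝ) {x : Eucl (m + 1)} (hx : inner ℝ x x = 1) :
    inner ℝ (dilNum t x) (dilNum t x) = dilDen t x ^ 2 := by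
  have h : inner ℝ x (north m : Eucl (m + 1)) = height x := real_inner_comm _ _
  simp only [dilNum, dilDen, inner_add_left, inner_add_right, inner_smul_left, inner_smul_right, hx,
    inner_self_sphere, h]
  simp
  ring

theorem inner_dilFun_self {t : ℝ} (ht : 0 < t) {x : Eucl (m + 1)} (hx : inner ℝ x x = 1) :
    inner ℝ (dilFun t x) (dilFun t x) = 1 := by
  have h := (dilDen_pos ht hx).ne'
  rw [dilFun, inner_smul_left, inner_smul_right, inner_dilNum_self t hx]
  simp
  field_simp

theorem dilFun_mem_sphere {t : ℝ} (ht : 0 < t) (p : Sph m) :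
    dilFun t (p : Eucl (m + 1)) ∈ Metric.sphere (0 : Eucl (m + 1)) 1 := by
  have h := inner_dilFun_self ht (inner_self_sphere p)
  rw [real_inner_self_eq_norm_sq] at h
  rw [mem_sphere_zero_iff_norm]
  nlinarith [norm_nonneg (dilFun t (p : Eucl (m + 1)))]

theorem height_dilFun (t : ℝ) (x : Eucl (m + 1)) :
    height (dilFun t x) = (dilDen t x)⁻¹ * ((1 - t ^ 2) + (1 + t ^ 2) * height x) := by
  simp only [height, dilFun, dilNum, inner_smul_right, inner_add_right, inner_self_sphere]
  ring

theorem contDiff_dilDen (t : ℝ) : ContDiff ℝ ∞ (dilDen t : Eucl (m + 1) → ℝ) :=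
  contDiff_const.add (contDiff_const.mul (innerSL ℝ (north m : Eucl (m + 1))).contDiff)

theorem contDiff_dilNum (t : ℝ) : ContDiff ℝ ∞ (dilNum t : Eucl (m + 1) → Eucl (m + 1)) :=
  (contDiff_id.const_smul (2 * t)).add ((contDiff_const.add (contDiff_const.mul
    (innerSL ℝ (north m : Eucl (m + 1))).contDiff)).smul contDiff_const)

theorem contDiffAt_dilFun {t : ℝ} {x : Eucl (m + 1)} (hx : dilDen t x ≠ 0) :
    ContDiffAt ℝ ∞ (dilFun t) x :=
  ((contDiff_dilDen t).contDiffAt.inv hx).smul (contDiff_dilNum t).contDiffAt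

/-- The conformal dilation of `S^m` by the factor `t > 0`. -/
def dilation {t : ℝ} (ht : 0 < t) : C^∞⟮𝓡 m, Sph m; 𝓡 m, Sph m⟯ :=
  ⟨Set.codRestrict (fun p : Sph m ↦ dilFun t (p : Eucl (m + 1))) _ (dilFun_mem_sphere ht), by
    refine ContMDiff.codRestrict_sphere (n := m) (f := fun p : Sph m ↦ dilFun t (p : Eucl (m + 1)))
      (fun p ↦ ?_) _
    exact (contDiffAt_dilFun (dilDen_pos ht (inner_self_sphere p)).ne').contMDiffAt.comp p
      (contMDiff_coe_sphere p)⟩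

theorem coe_dilation {t : ℝ} (ht : 0 < t) (p : Sph m) :
    (dilation ht p : Eucl (m + 1)) = dilFun t p := rfl

theorem dilFun_one (x : Eucl (m + 1)) : dilFun 1 x = x := by
  simp only [dilFun, dilDen, dilNum]
  norm_num [smul_smul]

theorem dilation_homotopic {t : ℝ} (ht : 0 < t) :
    ContinuousMap.Homotopic (dilation (m := m) ht : C(Sph m, Sph m))
      (ContinuousMap.id (Sph m)) := by
  -- The homotopy runs through the dilations along the segment from `t` to `1`, which stays in the
  -- positive reals.
  have hpos (s : unitInterval) : 0 < (s : ℝ) + (1 - s) * t := by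
    have h0 := s.2.1
    have h1 := s.2.2
    rcases h0.eq_or_lt with h | h
    · rw [← h]
      simpa using ht
    · have : 0 ≤ (1 - (s : ℝ)) * t := mul_nonneg (by linarith) ht.le
      linarith
  refine ⟨⟨⟨fun z ↦ ⟨dilFun ((z.1 : ℝ) + (1 - z.1) * t) z.2, dilFun_mem_sphere (hpos z.1) z.2⟩,
    ?_⟩, fun p ↦ ?_, fun p ↦ ?_⟩⟩
  · refine Continuous.subtype_mk ?_ _
    have h (z : unitInterval × Sph m) :
        dilDen ((z.1 : ℝ) + (1 - z.1) * t) (z.2 : Eucl (m + 1)) ≠ 0 :=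
      (dilDen_pos (hpos z.1) (inner_self_sphere z.2)).ne'
    refine Continuous.smul (Continuous.inv₀ ?_ h) ?_
    · unfold dilDen height
      fun_prop
    · unfold dilNum height
      fun_prop
  · ext1
    simp [coe_dilation]
  · ext1
    simp [dilFun_one]

theorem fderiv_dilFun {t : ℝ} {x : Eucl (m + 1)} (hx : dilDen t x ≠ 0) (u : Eucl (m + 1)) :
    fderiv ℝ (dilFun t) x u = (dilDen t x)⁻¹ • ((2 * t) • u + ((1 - t) ^ 2 * height u) •
      (north m : Eucl (m + 1)) - ((1 - t ^ 2) * height u) • dilFun t x) := by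
  have h0 : HasFDerivAt (height : Eucl (m + 1) → ℝ) (innerSL ℝ (north m : Eucl (m + 1))) x :=
    (innerSL ℝ (north m : Eucl (m + 1))).hasFDerivAt
  have h1 : HasFDerivAt (dilDen t) ((1 - t ^ 2) • innerSL ℝ (north m : Eucl (m + 1))) x :=
    (h0.const_mul (1 - t ^ 2)).const_add (1 + t ^ 2)
  have h2 := ((hasFDerivAt_id (𝕜 := ℝ) x).const_smul (2 * t)).add
    (((h0.const_mul ((1 - t) ^ 2)).const_add (1 - t ^ 2)).smul_const (north m : Eucl (m + 1)))
  have h3 : fderiv ℝ (dilFun t) x = _ :=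
    (((hasDerivAt_inv hx).comp_hasFDerivAt x h1).smul h2).fderiv
  rw [h3]
  simp [dilFun, dilNum, height]
  match_scalars <;> (field_simp; try ring)

/-- The algebraic identity behind conformality of the dilations. -/
theorem inner_dil_tangent {t : ℝ} (ht : 0 < t) {x u : Eucl (m + 1)} (hx : inner ℝ x x = 1)
    (hu : inner ℝ x u = 0) :
    inner ℝ (dilFun t x) ((2 * t) • u + ((1 - t) ^ 2 * height u) • (north m : Eucl (m + 1))) =
      (1 - t ^ 2) * height u := by
  have h := (dilDen_pos ht hx).ne'
  simp only [dilFun, dilNum, inner_smul_left, inner_add_left, inner_add_right, inner_smul_right,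
    inner_self_sphere, hu]
  rw [real_inner_comm (north m : Eucl (m + 1)) x]
  simp
  field_simp
  rw [dilDen]
  simp only [height]
  ring

/-- The term in excess of `4t² ⟨u, v⟩` is the product of the derivatives of `dilDen` along `u` and
`v`, exactly what removing the component along the image point cancels. -/
theorem inner_dil_tangent_tangent (t : ℝ) (u v : Eucl (m + 1)) :
    inner ℝ ((2 * t) • u + ((1 - t) ^ 2 * height u) • (north m : Eucl (m + 1)))
      ((2 * t) • v + ((1 - t) ^ 2 * height v) • (north m : Eucl (m + 1))) =
      4 * t ^ 2 * inner ℝ u v + (1 - t ^ 2) ^ 2 * height u * height v := by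
  simp only [inner_smul_left, inner_add_left, inner_add_right, inner_smul_right,
    inner_self_sphere]
  rw [real_inner_comm (north m : Eucl (m + 1)) u]
  simp
  simp only [height]
  ring

theorem inclD_mem_tangent (p : Sph m) (v : Eucl m) :
    inner ℝ (p : Eucl (m + 1)) (inclD m p v) = 0 := by
  have h : inclD m p v ∈ (ℝ ∙ (p : Eucl (m + 1)))ᗮ := by
    rw [← range_mvfderiv_subtypeVal (n := m) p]
    exact ⟨v, rfl⟩
  rwa [Submodule.mem_orthogonal_singleton_iff_inner_right] at h

theorem inclD_mfderiv_dilation {t : ℝ} (ht : 0 < t) (p : Sph m) (v : Eucl m) :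
    inclD m (dilation ht p) (mfderiv (𝓡 m) (𝓡 m) (dilation (m := m) ht) p v) =
      fderiv ℝ (dilFun t) (p : Eucl (m + 1)) (inclD m p v) := by
  have h1 : MDifferentiableAt (𝓡 m) (𝓡 m) (dilation (m := m) ht) p :=
    (dilation ht).contMDiff.mdifferentiableAt (by simp)
  have h2 (q : Sph m) : MDifferentiableAt (𝓡 m) 𝓘(ℝ, Eucl (m + 1))
      (Subtype.val : Sph m → Eucl (m + 1)) q :=
    (contMDiff_coe_sphere (m := ∞) q).mdifferentiableAt (by simp)
  have h3 := mfderiv_comp p (h2 _) h1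
  have h4 : MDifferentiableAt 𝓘(ℝ, Eucl (m + 1)) 𝓘(ℝ, Eucl (m + 1)) (dilFun t)
      (p : Eucl (m + 1)) :=
    (contDiffAt_dilFun (dilDen_pos ht (inner_self_sphere p)).ne').contMDiffAt.mdifferentiableAt
      (by simp)
  have h5 := mfderiv_comp p h4 (h2 p)
  have h6 : (Subtype.val : Sph m → Eucl (m + 1)) ∘ (dilation (m := m) ht) =
    dilFun t ∘ Subtype.val := rfl
  rw [h6, h5, mfderiv_eq_fderiv] at h3
  exact (congrArg (fun A : Eucl m →L[ℝ] Eucl (m + 1) ↦ A v) h3).symm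

/-- By the quotient rule the differential is `(N'u - (D'u) f) / D`. Since `⟨f, N'u⟩ = D'u` and `|f|
= 1`, the inner product of two images is `⟨N'v, N'w⟩ - D'v D'w` over `D²`, that is `4t² ⟨v, w⟩ /
D²`. -/
theorem dilation_isConformal {t : ℝ} (ht : 0 < t) :
    IsConformal (roundMetric m) (roundMetric m) (dilation ht) := by
  refine ⟨fun p ↦ (2 * t / dilDen t (p : Eucl (m + 1))) ^ 2, fun p ↦ ?_, fun p v w ↦ ?_⟩
  · have := dilDen_pos ht (inner_self_sphere p)
    positivity
  · have hx := inner_self_sphere p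
    have hD := (dilDen_pos ht hx).ne'
    refine (congrArg₂ (inner ℝ) (inclD_mfderiv_dilation ht p v)
      (inclD_mfderiv_dilation ht p w)).trans ?_
    change _ = _ * inner ℝ (inclD m p v) (inclD m p w)
    rw [fderiv_dilFun hD, fderiv_dilFun hD,
      inner_smul_left, inner_smul_right, inner_sub_left, inner_sub_right, inner_sub_right,
      inner_dil_tangent_tangent, inner_smul_left, inner_smul_left, inner_smul_right,
      inner_smul_right, inner_dil_tangent ht hx (inclD_mem_tangent p w),
      real_inner_comm (dilFun t _), inner_dil_tangent ht hx (inclD_mem_tangent p v),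
      inner_dilFun_self ht hx]
    simp
    field_simp
    ring

end Dilation

/-! ### The dilations in polar coordinates -/

section Polar

theorem half_angle {r : ℝ} (h0 : 0 < r) (h1 : r < Real.pi) :
    0 < Real.cos (r / 2) ∧ 0 < Real.sin (r / 2) ∧
      Real.sin (r / 2) ^ 2 + Real.cos (r / 2) ^ 2 = 1 ∧
      Real.sin r = 2 * Real.sin (r / 2) * Real.cos (r / 2) ∧
      Real.cos r = Real.cos (r / 2) ^ 2 - Real.sin (r / 2) ^ 2 := by
  refine ⟨Real.cos_pos_of_mem_Ioo ⟨by linarith, by linarith⟩,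
    Real.sin_pos_of_pos_of_lt_pi (by linarith) (by linarith), Real.sin_sq_add_cos_sq _, ?_, ?_⟩
  · rw [← Real.sin_two_mul, mul_div_cancel₀ r two_ne_zero]
  · rw [← Real.cos_two_mul', mul_div_cancel₀ r two_ne_zero]

theorem cos_two_mul_arctan (u : ℝ) :
    Real.cos (2 * Real.arctan u) = (1 - u ^ 2) / (1 + u ^ 2) := by
  have : 1 + u ^ 2 ≠ 0 := by positivity
  rw [Real.cos_two_mul, Real.cos_sq_arctan]
  field_simp
  ring

theorem sin_two_mul_arctan (u : ℝ) :
    Real.sin (2 * Real.arctan u) = 2 * u / (1 + u ^ 2) := by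
  have : 1 + u ^ 2 ≠ 0 := by positivity
  have h : Real.sin (Real.arctan u) = u * Real.cos (Real.arctan u) := by
    have := Real.tan_mul_cos (Real.cos_arctan_pos u).ne'
    rw [Real.tan_arctan] at this
    exact this.symm
  rw [Real.sin_two_mul, h]
  have e : 2 * (u * Real.cos (Real.arctan u)) * Real.cos (Real.arctan u) =
    2 * u * Real.cos (Real.arctan u) ^ 2 := by ring
  rw [e, Real.cos_sq_arctan]
  field_simp

theorem profile_den_pos {t : ℝ} (ht : 0 < t) {r : ℝ} (h0 : 0 < r) (h1 : r < Real.pi) :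
    0 < (1 + t ^ 2) + (1 - t ^ 2) * Real.cos r := by
  obtain ⟨hc, hs, h, -, e⟩ := half_angle h0 h1
  have : (1 + t ^ 2) + (1 - t ^ 2) * Real.cos r =
      2 * (Real.cos (r / 2) ^ 2 + t ^ 2 * Real.sin (r / 2) ^ 2) := by
    rw [e]
    linear_combination (-(1 + t ^ 2)) * h
  rw [this]
  positivity

theorem cos_profile {t : ℝ} (ht : 0 < t) {r : ℝ} (h0 : 0 < r) (h1 : r < Real.pi) :
    Real.cos (profile t r) =
      ((1 - t ^ 2) + (1 + t ^ 2) * Real.cos r) / ((1 + t ^ 2) + (1 - t ^ 2) * Real.cos r) := by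
  have hD := profile_den_pos ht h0 h1
  obtain ⟨hc, hs, h, -, e⟩ := half_angle h0 h1
  rw [profile, cos_two_mul_arctan, Real.tan_eq_sin_div_cos, div_eq_div_iff (by positivity) hD.ne',
    e]
  field_simp
  have hs2 : Real.sin (r / 2) ^ 2 = 1 - Real.cos (r / 2) ^ 2 := by linarith
  rw [hs2]
  ring

theorem sin_profile {t : ℝ} (ht : 0 < t) {r : ℝ} (h0 : 0 < r) (h1 : r < Real.pi) :
    Real.sin (profile t r) =
      2 * t * Real.sin r / ((1 + t ^ 2) + (1 - t ^ 2) * Real.cos r) := by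
  have hD := profile_den_pos ht h0 h1
  obtain ⟨hc, hs, h, es, e⟩ := half_angle h0 h1
  rw [profile, sin_two_mul_arctan, Real.tan_eq_sin_div_cos, div_eq_div_iff (by positivity) hD.ne',
    e, es]
  field_simp
  have hs2 : Real.sin (r / 2) ^ 2 = 1 - Real.cos (r / 2) ^ 2 := by linarith
  rw [hs2]
  ring

variable {m : ℕ}

theorem polar_last (θ : Metric.sphere (0 : Eucl m) 1) (r : ℝ) :
    (polar θ r : Eucl (m + 1)) (Fin.last m) = Real.cos r := by
  simp [polar]

theorem polar_castSucc (θ : Metric.sphere (0 : Eucl m) 1) (r : ℝ) (i : Fin m) :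
    (polar θ r : Eucl (m + 1)) i.castSucc = Real.sin r * (θ : Eucl m) i := by
  simp [polar]

theorem dilation_polar {t : ℝ} (ht : 0 < t) (θ : Metric.sphere (0 : Eucl m) 1) {r : ℝ}
    (h0 : 0 < r) (h1 : r < Real.pi) :
    dilation ht (polar θ r) = polar θ (profile t r) := by
  have hD := (profile_den_pos ht h0 h1).ne'
  have hh : height (polar θ r : Eucl (m + 1)) = Real.cos r := by rw [height_eq, polar_last]
  ext i
  rw [coe_dilation]
  refine Fin.lastCases ?_ (fun i ↦ ?_) i
  · rw [← height_eq, height_dilFun, polar_last, cos_profile ht h0 h1, dilDen, hh]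
    field_simp
  · rw [polar_castSucc, sin_profile ht h0 h1]
    simp only [dilFun, dilNum, dilDen, hh]
    simp [polar_castSucc, north]
    field_simp

end Polar

/-! ### Derivatives at the origin from the restriction to a coordinate axis -/

section LineDerivative

variable {m : ℕ}

theorem partialD_eq_deriv_line (i : Fin m) {f : Eucl m → ℝ} {s : ℝ}
    (hf : DifferentiableAt ℝ f (s • EuclideanSpace.single i 1)) :
    HasDerivAt (fun r : ℝ ↦ f (r • EuclideanSpace.single i 1))
      (partialD i f (s • EuclideanSpace.single i 1)) s := by
  have h : HasDerivAt (fun r : ℝ ↦ r • (EuclideanSpace.single i 1 : Eucl m))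
      (EuclideanSpace.single i 1) s := by
    simpa using (hasDerivAt_id s).smul_const (EuclideanSpace.single i (1 : ℝ) : Eucl m)
  exact hf.hasFDerivAt.comp_hasDerivAt s h

/-- The first and second partial derivatives at the origin of a function whose restriction to the
coordinate axis is a quotient of two quadratic polynomials. -/
theorem partialD_of_rational_line (i : Fin m) {f : Eucl m → ℝ} (hf : ContDiffAt ℝ ∞ f 0)
    {α β γ δ ε : ℝ} (hγ : γ ≠ 0)
    (h : ∀ s : ℝ, f (s • EuclideanSpace.single i 1) =
      (α * s + β * s ^ 2) / (γ + δ * s + ε * s ^ 2)) :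
    partialD i f 0 = α / γ ∧
      partialD i (partialD i f) 0 = 2 * (β / γ - α * δ / γ ^ 2) := by
  have hlim :
      Filter.Tendsto (fun s : ℝ ↦ s • (EuclideanSpace.single i 1 : Eucl m)) (𝓝 0) (𝓝 0) := by
    have : Continuous fun s : ℝ ↦ s • (EuclideanSpace.single i 1 : Eucl m) := by fun_prop
    simpa using this.tendsto 0
  have hdiff : ∀ᶠ y in 𝓝 (0 : Eucl m), DifferentiableAt ℝ f y := by
    filter_upwards [(hf.of_le (m := 1) (by exact_mod_cast le_top)).eventually (by simp)] with y hy
    exact hy.differentiableAt one_ne_zero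
  have hden : ∀ᶠ s in 𝓝 (0 : ℝ), γ + δ * s + ε * s ^ 2 ≠ 0 := by
    have : Continuous fun s : ℝ ↦ γ + δ * s + ε * s ^ 2 := by fun_prop
    exact this.continuousAt.eventually_ne (by simpa using hγ)
  have hnum (s : ℝ) : HasDerivAt (fun s : ℝ ↦ α * s + β * s ^ 2) (α + 2 * β * s) s := by
    convert! ((hasDerivAt_id s).const_mul α).add (((hasDerivAt_id s).pow 2).const_mul β) using 1
    simp
    ring
  have hden' (s : ℝ) : HasDerivAt (fun s : ℝ ↦ γ + δ * s + ε * s ^ 2) (δ + 2 * ε * s) s := by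
    convert! (((hasDerivAt_id s).const_mul δ).const_add γ).add
      (((hasDerivAt_id s).pow 2).const_mul ε) using 1
    simp
    ring
  have hquot (s : ℝ) (hs : γ + δ * s + ε * s ^ 2 ≠ 0) :
      HasDerivAt (fun r : ℝ ↦ f (r • EuclideanSpace.single i 1))
        (((α + 2 * β * s) * (γ + δ * s + ε * s ^ 2) - (α * s + β * s ^ 2) * (δ + 2 * ε * s)) /
          (γ + δ * s + ε * s ^ 2) ^ 2) s := by
    have : (fun r : ℝ ↦ f (r • EuclideanSpace.single i 1)) = fun s ↦ (α * s + β * s ^ 2) /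
      (γ + δ * s + ε * s ^ 2) := funext h
    rw [this]
    exact (hnum s).div (hden' s) hs
  -- The first derivative is needed on a whole neighbourhood of the origin in the axis, so that it
  -- can be differentiated once more.
  have hev : (fun s : ℝ ↦ partialD i f (s • EuclideanSpace.single i 1)) =ᶠ[𝓝 0] fun s ↦
      ((α + 2 * β * s) * (γ + δ * s + ε * s ^ 2) - (α * s + β * s ^ 2) * (δ + 2 * ε * s)) /
          (γ + δ * s + ε * s ^ 2) ^ 2 := by
    filter_upwards [hlim.eventually hdiff, hden] with s h1 h2
    exact (partialD_eq_deriv_line i h1).unique (hquot s h2)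
  constructor
  · have := hev.self_of_nhds
    simp only [zero_smul] at this
    rw [this]
    simp
    field_simp
  · have hd : DifferentiableAt ℝ (partialD i f) 0 := by
      have h1 : ContDiffAt ℝ 1 (fderiv ℝ f) 0 :=
        (hf.of_le (m := 2) ENat.LEInfty.out).fderiv_right (m := 1)
          (by rw [one_add_one_eq_two])
      exact (h1.clm_apply contDiffAt_const).differentiableAt one_ne_zero
    have h1 := partialD_eq_deriv_line (s := 0) i (by rwa [zero_smul])
    rw [zero_smul] at h1
    have hlin : HasDerivAt (fun s : ℝ ↦ α + 2 * β * s) (2 * β) 0 := by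
      simpa using ((hasDerivAt_id (0 : ℝ)).const_mul (2 * β)).const_add α
    have hlin' : HasDerivAt (fun s : ℝ ↦ δ + 2 * ε * s) (2 * ε) 0 := by
      simpa using ((hasDerivAt_id (0 : ℝ)).const_mul (2 * ε)).const_add δ
    have h2 := ((hlin.mul (hden' 0)).sub ((hnum 0).mul hlin')).div ((hden' 0).pow 2)
      (by simpa using hγ)
    have h3 := (h1.congr_of_eventuallyEq hev.symm).unique h2
    rw [h3]
    simp
    field_simp

end LineDerivative

/-! ### Tension field and energy density of a dilation -/

section Tension

variable {m : ℕ} {t : ℝ} (ht : 0 < t) (p : Sph m)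

theorem localRep_dilation (a : Fin m) (y : Eucl m) :
    localRep (dilation (m := m) ht) p a y =
      2 / (1 + inner ℝ (dilation ht p : Eucl (m + 1)) (dilFun t (param p y))) *
        inner ℝ (frame (dilation ht p) (EuclideanSpace.single a 1)) (dilFun t (param p y)) := by
  rw [localRep, chartAt_apply, coe_dilation ht ((chartAt (Eucl m) p).symm y), coe_chartAt_symm]

theorem contDiffAt_localRep_dilation (a : Fin m) :
    ContDiffAt ℝ ∞ (localRep (m := m) (n := m) (dilation (m := m) ht) p a) 0 := by
  have e : localRep (m := m) (n := m) (dilation (m := m) ht) p a = fun y ↦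
      2 / (1 + inner ℝ (dilation ht p : Eucl (m + 1)) (dilFun t (param p y))) *
        inner ℝ (frame (dilation ht p) (EuclideanSpace.single a 1)) (dilFun t (param p y)) :=
    funext (localRep_dilation ht p a)
  have h : ContDiffAt ℝ ∞ (fun y ↦ dilFun t (param p y)) 0 := by
    have h0 : ContDiffAt ℝ ∞ (dilFun t) (param p 0) :=
      contDiffAt_dilFun (by
        rw [param_zero]
        exact (dilDen_pos ht (inner_self_sphere p)).ne')
    exact ContDiffAt.comp (g := dilFun t) (f := param p) (0 : Eucl m) h0
      (contDiff_param p).contDiffAt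
  rw [e]
  refine ContDiffAt.mul (ContDiffAt.div contDiffAt_const
    (contDiffAt_const.add (contDiffAt_const.inner ℝ h)) ?_) (contDiffAt_const.inner ℝ h)
  rw [param_zero, ← coe_dilation ht, inner_self_sphere]
  norm_num

/-- On an axis `param p` is quadratic over `s² + 4`, and `dilNum`, `dilDen` are affine; clearing
both denominators leaves quadratics in `s`. The constant term of the numerator vanishes because the
frame at `q` is orthogonal to `dilNum t p`. The coefficient `ε` is left unspecified, as it affects
the quotient only from third order on. -/
theorem localRep_dilation_line (a i : Fin m) : ∃ ε : ℝ, ∀ s : ℝ,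
    localRep (dilation ht) p a (s • EuclideanSpace.single i 1) =
      (8 * inner ℝ (frame (dilation ht p) (EuclideanSpace.single a 1))
          ((2 * t) • frame p (EuclideanSpace.single i 1) +
            ((1 - t) ^ 2 * height (frame p (EuclideanSpace.single i 1))) •
              (north m : Eucl (m + 1))) * s
        + 4 * (1 - t ^ 2) * height (frame (dilation ht p) (EuclideanSpace.single a 1)) * s ^ 2) /
      (8 * dilDen t (p : Eucl (m + 1))
        + 8 * (1 - t ^ 2) * height (frame p (EuclideanSpace.single i 1)) * s + ε * s ^ 2) := by
  have hx := inner_self_sphere p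
  have hD := dilDen_pos ht hx
  have hq : (dilation ht p : Eucl (m + 1)) = (dilDen t (p : Eucl (m + 1)))⁻¹ • dilNum t p := rfl
  have hqs := inner_self_sphere (dilation ht p)
  have hE := inner_frame_left (dilation ht p) (EuclideanSpace.single a 1)
  have hQ1 := inner_dil_tangent ht hx (inner_frame p (EuclideanSpace.single i 1))
  rw [← coe_dilation ht] at hQ1
  have hnum : dilNum t (p : Eucl (m + 1)) =
      dilDen t (p : Eucl (m + 1)) • (dilation ht p : Eucl (m + 1)) := by
    rw [hq, smul_smul, mul_inv_cancel₀ hD.ne', one_smul]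
  set q : Eucl (m + 1) := (dilation ht p : Eucl (m + 1)) with hq'
  set e := frame (dilation ht p) (EuclideanSpace.single a 1) with he
  set u := frame p (EuclideanSpace.single i 1) with hu
  have hE0 : inner ℝ e (dilNum t (p : Eucl (m + 1))) = 0 := by
    rw [hnum, inner_smul_right, hE, mul_zero]
  have hQ0 : inner ℝ q (dilNum t (p : Eucl (m + 1))) = dilDen t (p : Eucl (m + 1)) := by
    rw [hnum, inner_smul_right, hqs, mul_one]
  have hk : inner ℝ e (north m : Eucl (m + 1)) = height e := real_inner_comm _ _
  refine ⟨(1 + t ^ 2) - (1 - t ^ 2) * height (p : Eucl (m + 1)) +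
    inner ℝ q (-(2 * t) • (p : Eucl (m + 1)) + ((1 - t ^ 2) - (1 - t) ^ 2 *
      height (p : Eucl (m + 1))) • (north m : Eucl (m + 1))), fun s ↦ ?_⟩
  have h4 : s ^ 2 + 4 ≠ 0 := by positivity
  have hpar : param p (s • EuclideanSpace.single i 1) =
      (s ^ 2 + 4)⁻¹ • ((4 * s) • u + (4 - s ^ 2) • (p : Eucl (m + 1))) := by
    rw [param, norm_smul, PiLp.norm_single, map_smul, smul_smul]
    simp [hu]
  have hD' : dilDen t (param p (s • EuclideanSpace.single i 1)) ≠ 0 :=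
    (dilDen_pos ht (by rw [real_inner_self_eq_norm_sq, norm_param, one_pow])).ne'
  rw [localRep_dilation, dilFun, inner_smul_right, inner_smul_right, div_mul_eq_mul_div,
    ← mul_div_mul_left _ _ (mul_ne_zero h4 hD'), ← hq', ← he]
  congr 1
  · rw [show ∀ h d n : ℝ, d ≠ 0 → h * d * (2 * (d⁻¹ * n)) = 2 * h * n by
      intro h d n hd
      field_simp, hpar]
    · simp only [dilNum, height, inner_add_right, inner_smul_right] at hE0 ⊢
      simp only [hk] at hE0 ⊢
      simp only [height] at hE0 ⊢
      field_simp
      linear_combination (2 * (4 - s ^ 2)) * hE0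
    · exact hD'
  · rw [show ∀ h d n : ℝ, d ≠ 0 → h * d * (1 + d⁻¹ * n) = h * (d + n) by
      intro h d n hd
      field_simp, hpar]
    · simp only [dilNum, dilDen, height, inner_add_right, inner_smul_right] at hQ0 hQ1 ⊢
      field_simp
      linear_combination 4 * s * hQ1 + 4 * hQ0
    · exact hD'

theorem partialD_localRep_dilation (a i : Fin m) :
    partialD i (localRep (dilation ht) p a) 0 =
      inner ℝ (frame (dilation ht p) (EuclideanSpace.single a 1))
          ((2 * t) • frame p (EuclideanSpace.single i 1) +
            ((1 - t) ^ 2 * height (frame p (EuclideanSpace.single i 1))) •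
              (north m : Eucl (m + 1))) / dilDen t (p : Eucl (m + 1)) := by
  have hD := (dilDen_pos ht (inner_self_sphere p)).ne'
  obtain ⟨ε, h⟩ := localRep_dilation_line ht p a i
  rw [(partialD_of_rational_line i (contDiffAt_localRep_dilation ht p a)
    (mul_ne_zero (by norm_num) hD) h).1]
  field_simp

theorem partialD_partialD_localRep_dilation (a i : Fin m) :
    partialD i (partialD i (localRep (dilation ht) p a)) 0 =
      (1 - t ^ 2) * height (frame (dilation ht p) (EuclideanSpace.single a 1)) /
          dilDen t (p : Eucl (m + 1))
        - 2 * (1 - t ^ 2) / dilDen t (p : Eucl (m + 1)) ^ 2 *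
          (height (frame p (EuclideanSpace.single i 1)) *
            inner ℝ (frame (dilation ht p) (EuclideanSpace.single a 1))
              ((2 * t) • frame p (EuclideanSpace.single i 1) +
                ((1 - t) ^ 2 * height (frame p (EuclideanSpace.single i 1))) •
                  (north m : Eucl (m + 1)))) := by
  have hD := (dilDen_pos ht (inner_self_sphere p)).ne'
  obtain ⟨ε, h⟩ := localRep_dilation_line ht p a i
  rw [(partialD_of_rational_line i (contDiffAt_localRep_dilation ht p a)
    (mul_ne_zero (by norm_num) hD) h).2]
  field_simp
  ring

theorem dInner_dilation (i j : Fin m) :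
    dInner (roundMetric m) (dilation ht) p i j =
      if i = j then (2 * t / dilDen t (p : Eucl (m + 1))) ^ 2 else 0 := by
  have hx := inner_self_sphere p
  have hD := (dilDen_pos ht hx).ne'
  simp only [dInner, gram_roundMetric_center]
  rw [chartAt_self]
  simp only [partialD_localRep_dilation, ite_mul, one_mul, zero_mul, Finset.sum_ite_eq,
    Finset.mem_univ, if_true, div_mul_div_comm]
  rw [← Finset.sum_div, sum_inner_frame, inner_dil_tangent_tangent, coe_dilation,
    inner_dil_tangent ht hx (inner_frame p _), inner_dil_tangent ht hx (inner_frame p _),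
    LinearIsometry.inner_map_map, EuclideanSpace.inner_single_left]
  by_cases h : i = j
  · simp [h]
    field_simp
    ring
  · simp [h]
    left
    ring

theorem dNormSq_dilation :
    dNormSq (roundMetric m) (roundMetric m) (dilation ht) p =
      m * (2 * t / dilDen t (p : Eucl (m + 1))) ^ 2 := by
  simp only [dNormSq, gramInv_roundMetric_center, dInner_dilation]
  simp

theorem ricciTrace_dilation :
    ricciTrace (roundMetric m) (roundMetric m) (dilation ht) p =
      ((m : ℝ) - 1) * (m * (2 * t / dilDen t (p : Eucl (m + 1))) ^ 2) := by
  simp only [ricciTrace, gramInv_roundMetric_center, dInner_dilation, ricciEndo_roundMetric]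
  simp
  ring

/-- At the centres of both charts the tension is the sum of the pure second derivatives. Their first
terms contribute `m` equal summands; the second terms collapse to `-2` times the same quantity,
whence the factor `m - 2`. -/
theorem tension_dilation (a : Fin m) :
    tension (roundMetric m) (roundMetric m) (dilation ht) p a =
      ((m : ℝ) - 2) * (1 - t ^ 2) / dilDen t (p : Eucl (m + 1)) *
        height (frame (dilation ht p) (EuclideanSpace.single a 1)) := by
  have hx := inner_self_sphere p
  have hD := (dilDen_pos ht hx).ne'
  simp only [tension, gramInv_roundMetric_center, secondForm]
  rw [chartAt_self, chartAt_self]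
  simp only [christoffel_roundMetric_center, zero_mul, Finset.sum_const_zero, sub_zero, add_zero,
    ite_mul, one_mul, Finset.sum_ite_eq, Finset.mem_univ, if_true,
    partialD_partialD_localRep_dilation, Finset.sum_sub_distrib]
  rw [← Finset.mul_sum]
  set e := frame (dilation ht p) (EuclideanSpace.single a 1) with he
  have hE : inner ℝ e (dilNum t (p : Eucl (m + 1))) = 0 := by
    have h0 := inner_frame_left (dilation ht p) (EuclideanSpace.single a 1)
    rw [coe_dilation, dilFun, inner_smul_right] at h0
    exact (mul_eq_zero.1 h0).resolve_left (inv_ne_zero hD)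
  have hk : inner ℝ e (north m : Eucl (m + 1)) = height e := real_inner_comm _ _
  have e1 := sum_inner_frame p (north m : Eucl (m + 1)) (north m)
  have e2 := sum_inner_frame p (north m : Eucl (m + 1)) e
  have hc (v : Eucl (m + 1)) : inner ℝ v (north m : Eucl (m + 1)) = height v := real_inner_comm _ _
  simp only [hc] at e1 e2
  have e3 : ∑ i, height (frame p (EuclideanSpace.single i 1)) * inner ℝ e
      ((2 * t) • frame p (EuclideanSpace.single i 1) + ((1 - t) ^ 2 *
        height (frame p (EuclideanSpace.single i 1))) • (north m : Eucl (m + 1))) =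
      2 * t * (height e - height (p : Eucl (m + 1)) * inner ℝ (p : Eucl (m + 1)) e) +
        (1 - t) ^ 2 * height e * (1 - height (p : Eucl (m + 1)) ^ 2) := by
    have hn : height (north m : Eucl (m + 1)) = 1 := inner_self_sphere _
    rw [hn] at e1
    have e2' : ∑ i, height (frame p (EuclideanSpace.single i 1)) *
      inner ℝ (frame p (EuclideanSpace.single i 1)) e =
        height e - height (p : Eucl (m + 1)) * inner ℝ (p : Eucl (m + 1)) e := e2
    rw [sq (height (p : Eucl (m + 1))), ← e1, ← e2', Finset.mul_sum, Finset.mul_sum,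
      ← Finset.sum_add_distrib]
    refine Finset.sum_congr rfl fun i _ ↦ ?_
    rw [inner_add_right, inner_smul_right, inner_smul_right, hk,
      real_inner_comm e]
    ring
  rw [e3]
  simp only [dilNum, inner_add_right, inner_smul_right, hk] at hE
  rw [real_inner_comm (p : Eucl (m + 1)) e] at hE
  simp only [Finset.sum_const, Finset.card_univ, Fintype.card_fin, nsmul_eq_mul]
  field_simp
  rw [dilDen]
  -- Orthogonality of `e` to `dilNum t p` expresses `2t ⟨p, e⟩` through `height e`, which turns the
  -- sum in `e3` into `dilDen t p * height e`.
  linear_combination (2 * (1 - t ^ 2) * height (p : Eucl (m + 1))) * hE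

/-- By Parseval the tangential part of the north pole at the image point has squared length one
minus the squared height. -/
theorem tensionNormSq_dilation :
    tensionNormSq (roundMetric m) (roundMetric m) (dilation ht) p =
      (((m : ℝ) - 2) * (1 - t ^ 2) / dilDen t (p : Eucl (m + 1))) ^ 2 *
        (1 - height (dilFun t (p : Eucl (m + 1))) ^ 2) := by
  simp only [tensionNormSq, gram_roundMetric_center, tension_dilation]
  have e1 := sum_inner_frame (dilation ht p) (north m : Eucl (m + 1)) (north m)
  have hc (v : Eucl (m + 1)) : inner ℝ v (north m : Eucl (m + 1)) = height v := real_inner_comm _ _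
  have hn : height (north m : Eucl (m + 1)) = 1 := inner_self_sphere _
  simp only [hc, hn, coe_dilation] at e1
  rw [sq (height (dilFun t (p : Eucl (m + 1)))), ← e1, Finset.mul_sum]
  refine Finset.sum_congr rfl fun a _ ↦ ?_
  simp
  ring

end Tension

/-! ### The Riemannian volume and integration of functions of the height -/

section Volume

variable {m : ℕ}

/-- The determinant of a linear similarity of ratio `c`. -/
theorem abs_det_of_inner_map {T : Eucl m →L[ℝ] Eucl m} {c : ℝ} (hc : 0 ≤ c)
    (h : ∀ v w, inner ℝ (T v) (T w) = c ^ 2 * inner ℝ v w) : |T.det| = c ^ m := by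
  let b := (EuclideanSpace.basisFun (Fin m) ℝ).toBasis
  have h1 : (LinearMap.toMatrix b b (T : Eucl m →ₗ[ℝ] Eucl m)).transpose *
      LinearMap.toMatrix b b (T : Eucl m →ₗ[ℝ] Eucl m) =
        (c ^ 2) • (1 : Matrix (Fin m) (Fin m) ℝ) := by
    ext i j
    have := h (EuclideanSpace.single i 1) (EuclideanSpace.single j 1)
    rw [EuclideanSpace.inner_single_left, PiLp.inner_apply] at this
    rw [Matrix.mul_apply, Matrix.smul_apply, Matrix.one_apply]
    simp only [Matrix.transpose_apply, LinearMap.toMatrix_apply, b]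
    simpa [mul_comm] using this
  have h2 := congrArg Matrix.det h1
  rw [Matrix.det_mul, Matrix.det_transpose, LinearMap.det_toMatrix, Matrix.det_smul,
    Matrix.det_one, Fintype.card_fin, mul_one, ← pow_mul] at h2
  have h3 : T.det ^ 2 = (c ^ m) ^ 2 := by
    rw [sq, ← pow_mul, mul_comm m 2]
    exact h2
  rw [← abs_of_nonneg (pow_nonneg hc m)]
  exact (sq_eq_sq_iff_abs_eq_abs _ _).1 h3

theorem sqrt_det_gram_roundMetric (p : Sph m) (y : Eucl m) :
    Real.sqrt (gram (roundMetric m) p y).det = (4 / (‖y‖ ^ 2 + 4)) ^ m := by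
  rw [gram_roundMetric, Matrix.det_smul, Matrix.det_one, mul_one, Fintype.card_fin]
  have : (16 / (‖y‖ ^ 2 + 4) ^ 2) ^ m = ((4 / (‖y‖ ^ 2 + 4)) ^ m) ^ 2 := by
    rw [← pow_mul, mul_comm m 2, pow_mul, div_pow 4]
    norm_num
  rw [this, Real.sqrt_sq (by positivity)]

theorem isOpenEmbedding_chartAt_symm (p : Sph m) :
    Topology.IsOpenEmbedding (chartAt (Eucl m) p).symm :=
  (chartAt (Eucl m) p).symm.isOpenEmbedding (chartAt_target p)

theorem measurable_chartDensity :
    Measurable fun y : Eucl m ↦ ENNReal.ofReal ((4 / (‖y‖ ^ 2 + 4)) ^ m) := by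
  fun_prop

theorem chartVolume_roundMetric (p : Sph m) :
    chartVolume (roundMetric m) p =
      ((volume : Measure (Eucl m)).withDensity
        fun y ↦ ENNReal.ofReal ((4 / (‖y‖ ^ 2 + 4)) ^ m)).map (chartAt (Eucl m) p).symm := by
  simp only [chartVolume, sqrt_det_gram_roundMetric, chartAt_target, Measure.restrict_univ]

theorem chartVolume_apply (p : Sph m) {s : Set (Sph m)} (hs : MeasurableSet s) :
    chartVolume (roundMetric m) p s =
      ∫⁻ y in (chartAt (Eucl m) p).symm ⁻¹' s, ENNReal.ofReal ((4 / (‖y‖ ^ 2 + 4)) ^ m) := by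
  have h := (isOpenEmbedding_chartAt_symm p).continuous.measurable
  rw [chartVolume_roundMetric, Measure.map_apply h hs, withDensity_apply _ (h hs)]

theorem chartAt_symm_ne (p : Sph m) (y : Eucl m) : (chartAt (Eucl m) p).symm y ≠ -p := by
  have h := (chartAt (Eucl m) p).map_target (x := y) (by rw [chartAt_target]; trivial)
  rw [chartAt_source] at h
  exact h

theorem chartAt_symm_chartAt {p z : Sph m} (hz : z ≠ -p) :
    (chartAt (Eucl m) p).symm (chartAt (Eucl m) p z) = z :=
  (chartAt (Eucl m) p).left_inv (by rw [chartAt_source]; exact hz)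

theorem chartAt_chartAt_symm (p : Sph m) (y : Eucl m) :
    chartAt (Eucl m) p ((chartAt (Eucl m) p).symm y) = y :=
  (chartAt (Eucl m) p).right_inv (by rw [chartAt_target]; trivial)

theorem differentiableAt_transition (p q : Sph m) {y : Eucl m}
    (hy : (chartAt (Eucl m) p).symm y ≠ -q) :
    DifferentiableAt ℝ (fun y ↦ chartAt (Eucl m) q ((chartAt (Eucl m) p).symm y)) y := by
  rw [differentiableAt_euclidean]
  intro a
  simp only [chartAt_apply, coe_chartAt_symm]
  have hp : DifferentiableAt ℝ (param p) y :=
    (contDiff_param p).contDiffAt.differentiableAt (by simp)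
  -- Two unit vectors have inner product `-1` only if they are antipodal.
  have hne : 1 + inner ℝ (q : Eucl (m + 1)) (param p y) ≠ 0 := by
    intro h0
    have h1 : inner ℝ (q : Eucl (m + 1)) (param p y) = -1 := by linarith
    rw [inner_eq_neg_one_iff_of_norm_eq_one (norm_eq_of_mem_sphere q) (norm_param p y)] at h1
    refine hy (Subtype.ext ?_)
    rw [coe_chartAt_symm, coe_neg_sphere, h1, neg_neg]
  have hi (v : Eucl (m + 1)) : DifferentiableAt ℝ (fun y ↦ inner ℝ v (param p y)) y :=
    (differentiableAt_const v).inner ℝ hp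
  simp only [div_eq_mul_inv]
  exact ((((hi (q : Eucl (m + 1))).const_add 1).fun_inv hne).const_mul 2).fun_mul (hi _)

/-- Differentiating `param q ∘ ψ = param p` and comparing the conformal factors of the two
parametrizations shows that the differential of the transition `ψ` is a similarity of known ratio.
-/
theorem abs_det_transition (p q : Sph m) {y : Eucl m}
    (hy : (chartAt (Eucl m) p).symm y ≠ -q) :
    |(fderiv ℝ (fun y ↦ chartAt (Eucl m) q ((chartAt (Eucl m) p).symm y)) y).det| *
      (4 / (‖chartAt (Eucl m) q ((chartAt (Eucl m) p).symm y)‖ ^ 2 + 4)) ^ m =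
        (4 / (‖y‖ ^ 2 + 4)) ^ m := by
  have hd := differentiableAt_transition p q hy
  set ψ : Eucl m → Eucl m := fun y ↦ chartAt (Eucl m) q ((chartAt (Eucl m) p).symm y) with hψ
  have hev : param q ∘ ψ =ᶠ[𝓝 y] param p := by
    have ho : ∀ᶠ z in 𝓝 y, (chartAt (Eucl m) p).symm z ≠ -q :=
      (isOpenEmbedding_chartAt_symm p).continuous.continuousAt.eventually_ne hy
    filter_upwards [ho] with z hz
    rw [Function.comp_apply, ← coe_chartAt_symm, ← coe_chartAt_symm, hψ, chartAt_symm_chartAt hz]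
  have hq : DifferentiableAt ℝ (param q) (ψ y) :=
    (contDiff_param q).contDiffAt.differentiableAt (by simp)
  have hcomp := hev.fderiv_eq (𝕜 := ℝ)
  rw [fderiv_comp y hq hd] at hcomp
  have hpos : 0 < ‖y‖ ^ 2 + 4 := by positivity
  have hpos' : 0 < ‖ψ y‖ ^ 2 + 4 := by positivity
  have hin (v w : Eucl m) : inner ℝ (fderiv ℝ ψ y v) (fderiv ℝ ψ y w) =
      ((‖ψ y‖ ^ 2 + 4) / (‖y‖ ^ 2 + 4)) ^ 2 * inner ℝ v w := by
    have h1 := inner_fderiv_param q (ψ y) (fderiv ℝ ψ y v) (fderiv ℝ ψ y w)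
    have h2 := inner_fderiv_param p y v w
    rw [← hcomp] at h2
    have h3 := h1.symm.trans h2
    field_simp at h3 ⊢
    linarith
  rw [abs_det_of_inner_map (by positivity) hin, ← mul_pow]
  congr 1
  change (‖ψ y‖ ^ 2 + 4) / (‖y‖ ^ 2 + 4) * (4 / (‖ψ y‖ ^ 2 + 4)) = _
  field_simp

theorem setLIntegral_chart_sdiff [Nontrivial (Eucl m)] (p q : Sph m) (s : Set (Sph m))
    (w : Eucl m → ENNReal) :
    ∫⁻ y in (chartAt (Eucl m) p).symm ⁻¹' (s \ {q}), w y =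
      ∫⁻ y in (chartAt (Eucl m) p).symm ⁻¹' s, w y := by
  refine setLIntegral_congr ?_
  rw [Set.preimage_sdiff]
  refine sdiff_null_ae_eq_self ?_
  refine (Set.Subsingleton.preimage Set.subsingleton_singleton
    (isOpenEmbedding_chartAt_symm p).injective).measure_zero _

/-- Each chart misses one point. Discarding both missed points, which are null as the dimension is
positive, leaves the change of variables along the transition map. Hence the supremum defining the
volume is over a constant family. -/
theorem chartVolume_eq [Nontrivial (Eucl m)] (p q : Sph m) :
    chartVolume (roundMetric m) p = chartVolume (roundMetric m) q := by
  ext s hs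
  rw [chartVolume_apply p hs, chartVolume_apply q hs, ← setLIntegral_chart_sdiff p (-q),
    ← setLIntegral_chart_sdiff q (-p)]
  have himage : (fun y ↦ chartAt (Eucl m) q ((chartAt (Eucl m) p).symm y)) ''
      ((chartAt (Eucl m) p).symm ⁻¹' (s \ {-q})) = (chartAt (Eucl m) q).symm ⁻¹' (s \ {-p}) := by
    ext z
    constructor
    · rintro ⟨y, ⟨hy, hy'⟩, rfl⟩
      rw [Set.mem_preimage, chartAt_symm_chartAt hy']
      exact ⟨hy, chartAt_symm_ne p y⟩
    · rintro ⟨hz, hz'⟩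
      refine ⟨chartAt (Eucl m) p ((chartAt (Eucl m) q).symm z), ?_, ?_⟩
      · rw [Set.mem_preimage, chartAt_symm_chartAt hz']
        exact ⟨hz, chartAt_symm_ne q z⟩
      · simp only
        rw [chartAt_symm_chartAt hz', chartAt_chartAt_symm]
  rw [← himage, lintegral_image_eq_lintegral_abs_det_fderiv_mul volume
    ((isOpenEmbedding_chartAt_symm p).continuous.measurable (hs.diff (measurableSet_singleton _)))
    (fun y hy ↦ (differentiableAt_transition p q hy.2).hasFDerivAt.hasFDerivWithinAt)
    (fun y hy z hz h ↦ (isOpenEmbedding_chartAt_symm p).injective (by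
      have := congrArg (chartAt (Eucl m) q).symm h
      simpa only [chartAt_symm_chartAt hy.2, chartAt_symm_chartAt hz.2] using this))]
  refine setLIntegral_congr_fun ((isOpenEmbedding_chartAt_symm p).continuous.measurable
    (hs.diff (measurableSet_singleton _))) fun y hy ↦ ?_
  rw [← ENNReal.ofReal_mul (abs_nonneg _), abs_det_transition p q hy.2]

theorem volumeMeasure_roundMetric [Nontrivial (Eucl m)] (p : Sph m) :
    volumeMeasure (roundMetric m) = chartVolume (roundMetric m) p := by
  have : Nonempty (Sph m) := ⟨p⟩
  rw [volumeMeasure, iSup_congr fun q ↦ chartVolume_eq q p, iSup_const]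

theorem height_param_north (y : Eucl m) :
    height (param (north m) y) = (4 - ‖y‖ ^ 2) / (‖y‖ ^ 2 + 4) := by
  simp only [height, param, inner_smul_right, inner_add_right, inner_frame, inner_self_sphere]
  ring

/-- The substitution `ρ = 2 tan (r/2)`. -/
theorem integral_Ioi_eq_integral_tan_half (g : ℝ → ℝ) :
    ∫ ρ in Set.Ioi (0 : ℝ), g ρ = ∫ r in Set.Ioo (0 : ℝ) Real.pi,
      (1 / Real.cos (r / 2) ^ 2) * g (2 * Real.tan (r / 2)) := by
  have himage : (fun r : ℝ ↦ 2 * Real.tan (r / 2)) '' Set.Ioo 0 Real.pi = Set.Ioi 0 := by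
    ext ρ
    constructor
    · rintro ⟨r, ⟨h0, h1⟩, rfl⟩
      have := Real.tan_pos_of_pos_of_lt_pi_div_two (x := r / 2) (by linarith) (by linarith)
      exact mul_pos two_pos this
    · intro hρ
      have h1 := Real.arctan_lt_pi_div_two (ρ / 2)
      have h2 : 0 < Real.arctan (ρ / 2) := Real.arctan_pos.2 (half_pos hρ)
      refine ⟨2 * Real.arctan (ρ / 2), ⟨by linarith, by linarith⟩, ?_⟩
      simp only
      rw [mul_div_cancel_left₀ _ two_ne_zero, Real.tan_arctan]
      ring
  have hderiv (r : ℝ) (hr : r ∈ Set.Ioo 0 Real.pi) :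
      HasDerivWithinAt (fun r : ℝ ↦ 2 * Real.tan (r / 2)) (1 / Real.cos (r / 2) ^ 2)
        (Set.Ioo 0 Real.pi) r := by
    have hc := (half_angle hr.1 hr.2).1.ne'
    have h := ((Real.hasDerivAt_tan hc).comp r ((hasDerivAt_id r).div_const 2)).const_mul 2
    convert! h.hasDerivWithinAt using 1
    field_simp
  have hinj : Set.InjOn (fun r : ℝ ↦ 2 * Real.tan (r / 2)) (Set.Ioo 0 Real.pi) := by
    intro r hr s hs h
    have h1 : Real.tan (r / 2) = Real.tan (s / 2) := mul_left_cancel₀ two_ne_zero h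
    have h2 := Real.injOn_tan (x₁ := r / 2) (x₂ := s / 2)
      ⟨by linarith [hr.1, Real.pi_pos], by linarith [hr.2]⟩
      ⟨by linarith [hs.1, Real.pi_pos], by linarith [hs.2]⟩ h1
    linarith
  rw [← himage, integral_image_eq_integral_abs_deriv_smul measurableSet_Ioo hderiv hinj]
  refine setIntegral_congr_fun measurableSet_Ioo fun r _ ↦ ?_
  simp only [smul_eq_mul]
  rw [abs_of_nonneg (by positivity)]

/-- Integration over `S^m` of a function of the polar angle. -/
theorem integral_height (hm : m ≠ 0) (f : ℝ → ℝ) :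
    ∫ p, f (height (p : Eucl (m + 1))) ∂(volumeMeasure (roundMetric m)) =
      sphereVolume m * ∫ r in Set.Ioo (0 : ℝ) Real.pi,
        Real.sin r ^ (m - 1) * f (Real.cos r) := by
  have : NeZero m := ⟨hm⟩
  have : Nontrivial (Eucl m) := inferInstance
  rw [volumeMeasure_roundMetric (north m), chartVolume_roundMetric,
    (isOpenEmbedding_chartAt_symm (north m)).measurableEmbedding.integral_map,
    integral_withDensity_eq_integral_toReal_smul measurable_chartDensity
      (Filter.Eventually.of_forall fun _ ↦ ENNReal.ofReal_lt_top)]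
  simp only [coe_chartAt_symm, height_param_north]
  -- In the chart at the north pole both the density and the height are radial, so the integral
  -- reduces to one over the norm `ρ` with weight `ρ^(m-1)`.
  have e := integral_fun_norm_addHaar (volume : Measure (Eucl m)) fun ρ : ℝ ↦
    (ENNReal.ofReal ((4 / (ρ ^ 2 + 4)) ^ m)).toReal • f ((4 - ρ ^ 2) / (ρ ^ 2 + 4))
  rw [e, sphereVolume, Measure.toSphere_real_apply_univ, nsmul_eq_mul, smul_eq_mul, ← mul_assoc,
    integral_Ioi_eq_integral_tan_half]
  congr 1
  refine setIntegral_congr_fun measurableSet_Ioo fun r hr ↦ ?_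
  obtain ⟨hc, hs, h, es, ec⟩ := half_angle hr.1 hr.2
  have hden : (2 * Real.tan (r / 2)) ^ 2 + 4 = 4 / Real.cos (r / 2) ^ 2 := by
    rw [Real.tan_eq_sin_div_cos]
    field_simp
    linear_combination 4 * h
  have h1 : 4 / ((2 * Real.tan (r / 2)) ^ 2 + 4) = Real.cos (r / 2) ^ 2 := by
    rw [hden]
    field_simp
  have h2 : (4 - (2 * Real.tan (r / 2)) ^ 2) / ((2 * Real.tan (r / 2)) ^ 2 + 4) = Real.cos r := by
    rw [hden, Real.tan_eq_sin_div_cos, ec]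
    field_simp
    ring
  obtain ⟨k, rfl⟩ := Nat.exists_eq_succ_of_ne_zero hm
  simp only [smul_eq_mul]
  rw [h1, h2, ENNReal.toReal_ofReal (by positivity), finrank_euclideanSpace_fin, es,
    Real.tan_eq_sin_div_cos, Nat.succ_eq_add_one, Nat.add_sub_cancel]
  -- The density is `cos^(2m) (r/2)`; one factor `cos² (r/2)` cancels the Jacobian of `ρ = 2 tan
  -- (r/2)`, and the others turn `ρ^(m-1)` into `sin^(m-1) r`.
  have h3 : (2 * (Real.sin (r / 2) / Real.cos (r / 2))) ^ k * (Real.cos (r / 2) ^ 2) ^ k =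
      (2 * Real.sin (r / 2) * Real.cos (r / 2)) ^ k := by
    rw [← mul_pow]
    congr 1
    field_simp
  rw [← h3]
  field_simp
  ring

end Volume

/-! ### The energy integral and its limit -/

section Energy

variable {m : ℕ}

/-- The radial integrand of the conformal-bienergy of the dilation by the factor `t`. -/
def radialEnergyDensity (m : ℕ) (t r : ℝ) : ℝ :=
  Real.sin (profile t r) ^ 2 *
    (((m : ℝ) - 2) ^ 2 * Real.sin r ^ (m - 5) * (Real.cos (profile t r) - Real.cos r) ^ 2
      + (2 / 3) * (m : ℝ) * ((m : ℝ) - 1) * ((m : ℝ) - 3) * Real.sin r ^ (m - 3))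

/-- The conformal-bienergy density of the dilation by the factor `t` at a point of height `c`. -/
def heightEnergyDensity (m : ℕ) (t c : ℝ) : ℝ :=
  (((m : ℝ) - 2) * (1 - t ^ 2) / ((1 + t ^ 2) + (1 - t ^ 2) * c)) ^ 2 *
      (1 - (((1 + t ^ 2) + (1 - t ^ 2) * c)⁻¹ * ((1 - t ^ 2) + (1 + t ^ 2) * c)) ^ 2)
    + (2 / 3) * ((m : ℝ) * ((m : ℝ) - 1)) *
        (m * (2 * t / ((1 + t ^ 2) + (1 - t ^ 2) * c)) ^ 2)
    - 2 * (((m : ℝ) - 1) * (m * (2 * t / ((1 + t ^ 2) + (1 - t ^ 2) * c)) ^ 2))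

/-- The square of `cos α - cos r` absorbs `sin⁴ r` from the volume element and `λ² = sin² α / sin²
r` absorbs `sin² r`, leaving exponents `m - 5` and `m - 3`. The bound on `m` keeps these natural
subtractions from truncating. -/
theorem sin_pow_mul_heightEnergyDensity (hm : 5 ≤ m) {t : ℝ} (ht : 0 < t) {r : ℝ} (h0 : 0 < r)
    (h1 : r < Real.pi) :
    Real.sin r ^ (m - 1) * heightEnergyDensity m t (Real.cos r) = radialEnergyDensity m t r := by
  have hD := (profile_den_pos ht h0 h1).ne'
  obtain ⟨k, rfl⟩ := Nat.exists_eq_add_of_le hm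
  have hs := Real.sin_sq_add_cos_sq (profile t r)
  have hs2 : Real.sin r ^ 2 = 1 - Real.cos r ^ 2 := by
    linarith [Real.sin_sq_add_cos_sq r]
  have e1 : 1 - (((1 + t ^ 2) + (1 - t ^ 2) * Real.cos r)⁻¹ *
      ((1 - t ^ 2) + (1 + t ^ 2) * Real.cos r)) ^ 2 = Real.sin (profile t r) ^ 2 := by
    rw [← div_eq_inv_mul, ← cos_profile ht h0 h1]
    linarith
  have e2 : Real.cos (profile t r) - Real.cos r =
      (1 - t ^ 2) * Real.sin r ^ 2 / ((1 + t ^ 2) + (1 - t ^ 2) * Real.cos r) := by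
    rw [cos_profile ht h0 h1, hs2]
    field_simp
    ring
  rw [heightEnergyDensity, radialEnergyDensity, e1, e2, sin_profile ht h0 h1,
    show 5 + k - 1 = k + 4 by omega, show 5 + k - 5 = k by omega, show 5 + k - 3 = k + 2 by omega]
  field_simp
  ring

theorem cBienergy_dilation (hm : 5 ≤ m) {t : ℝ} (ht : 0 < t) :
    cBienergy (roundMetric m) (roundMetric m) (dilation ht) =
      (1 / 2) * sphereVolume m * ∫ r in (0 : ℝ)..Real.pi, radialEnergyDensity m t r := by
  have e (p : Sph m) : tensionNormSq (roundMetric m) (roundMetric m) (dilation ht) p +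
      (2 / 3) * scalarCurvature (roundMetric m) p *
        dNormSq (roundMetric m) (roundMetric m) (dilation ht) p -
      2 * ricciTrace (roundMetric m) (roundMetric m) (dilation ht) p =
      heightEnergyDensity m t (height (p : Eucl (m + 1))) := by
    rw [tensionNormSq_dilation, scalarCurvature_roundMetric, dNormSq_dilation,
      ricciTrace_dilation, height_dilFun]
    rfl
  rw [cBienergy, integral_congr_ae (Filter.Eventually.of_forall e),
    integral_height (by omega), mul_assoc,
    intervalIntegral.integral_of_le Real.pi_pos.le, integral_Ioc_eq_integral_Ioo]
  congr 2
  exact setIntegral_congr_fun measurableSet_Ioo fun r hr ↦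
    sin_pow_mul_heightEnergyDensity hm ht hr.1 hr.2

theorem norm_radialEnergyDensity_le (m : ℕ) (t r : ℝ) :
    ‖radialEnergyDensity m t r‖ ≤
      ((m : ℝ) - 2) ^ 2 * 4 + |(2 / 3) * (m : ℝ) * ((m : ℝ) - 1) * ((m : ℝ) - 3)| := by
  have hpow (k : ℕ) : |Real.sin r ^ k| ≤ 1 := by
    rw [abs_pow]
    exact pow_le_one₀ (abs_nonneg _) (Real.abs_sin_le_one r)
  have h1 : |Real.sin (profile t r) ^ 2| ≤ 1 := by
    rw [abs_pow]
    exact pow_le_one₀ (abs_nonneg _) (Real.abs_sin_le_one _)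
  have h2 : |(Real.cos (profile t r) - Real.cos r) ^ 2| ≤ 4 := by
    have h3 : |Real.cos (profile t r) - Real.cos r| ≤ 2 := by
      refine (abs_sub _ _).trans ?_
      linarith [Real.abs_cos_le_one (profile t r), Real.abs_cos_le_one r]
    rw [abs_pow]
    nlinarith [abs_nonneg (Real.cos (profile t r) - Real.cos r)]
  rw [Real.norm_eq_abs, radialEnergyDensity, abs_mul]
  refine (mul_le_of_le_one_left (abs_nonneg _) h1).trans ((abs_add_le _ _).trans ?_)
  refine add_le_add ?_ ?_
  · rw [mul_assoc, abs_mul, abs_mul, abs_of_nonneg (sq_nonneg ((m : ℝ) - 2))]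
    refine mul_le_mul_of_nonneg_left ?_ (sq_nonneg _)
    exact (mul_le_of_le_one_left (abs_nonneg _) (hpow _)).trans h2
  · rw [abs_mul]
    exact mul_le_of_le_one_right (abs_nonneg _) (hpow _)

/-- Dominated convergence with a constant bound: for fixed `r` the integrand is continuous in `t`
and vanishes at `t = 0`, where the profile is zero. -/
theorem tendsto_integral_radialEnergyDensity (m : ℕ) :
    Filter.Tendsto (fun t : ℝ ↦ ∫ r in (0 : ℝ)..Real.pi, radialEnergyDensity m t r)
      (𝓝[>] 0) (𝓝 0) := by
  have h := intervalIntegral.tendsto_integral_filter_of_dominated_convergence (μ := volume)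
    (a := 0) (b := Real.pi) (l := 𝓝[>] (0 : ℝ)) (F := fun t r ↦ radialEnergyDensity m t r)
    (f := fun _ ↦ 0)
    (fun _ ↦ ((m : ℝ) - 2) ^ 2 * 4 + |(2 / 3) * (m : ℝ) * ((m : ℝ) - 1) * ((m : ℝ) - 3)|)
    (Filter.Eventually.of_forall fun t ↦ ?_)
    (Filter.Eventually.of_forall fun t ↦ Filter.Eventually.of_forall fun r _ ↦
      norm_radialEnergyDensity_le m t r)
    intervalIntegrable_const
    (Filter.Eventually.of_forall fun r _ ↦ ?_)
  · simpa using h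
  · have htan : Measurable Real.tan := by
      have : Real.tan = fun x ↦ Real.sin x / Real.cos x := funext Real.tan_eq_sin_div_cos
      rw [this]
      exact Real.measurable_sin.div Real.measurable_cos
    have hprof : Measurable (profile t) :=
      (Real.measurable_arctan.comp
        ((htan.comp (measurable_id.div_const 2)).const_mul t)).const_mul 2
    have : Measurable (radialEnergyDensity m t) := by
      unfold radialEnergyDensity
      fun_prop
    exact this.aestronglyMeasurable
  · have hcont : Continuous fun t ↦ radialEnergyDensity m t r := by
      unfold radialEnergyDensity profile
      fun_prop
    have h0 : radialEnergyDensity m 0 r = 0 := by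
      simp [radialEnergyDensity, profile]
    have := hcont.tendsto 0
    rw [h0] at this
    exact this.mono_left nhdsWithin_le_nhds

end Energy

end CBienergy

end

/-! ### Assembly of the theorem -/

theorem mainTheorem2 (m : ℕ) (hm : 5 ≤ m) :
    (∀ ε : ℝ, 0 < ε →
      ∃ φ : C^∞⟮𝓡 m, CBienergy.Sph m; 𝓡 m, CBienergy.Sph m⟯,
        ContinuousMap.Homotopic (φ : C(CBienergy.Sph m, CBienergy.Sph m))
          (ContinuousMap.id (CBienergy.Sph m)) ∧
        CBienergy.cBienergy (CBienergy.roundMetric m) (CBienergy.roundMetric m) φ < ε) ∧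
    ∃ Φ : ℝ → C^∞⟮𝓡 m, CBienergy.Sph m; 𝓡 m, CBienergy.Sph m⟯,
      (∀ t : ℝ, 0 < t →
        (∀ (θ : Metric.sphere (0 : CBienergy.Eucl m) 1) (r : ℝ), 0 < r → r < Real.pi →
          Φ t (CBienergy.polar θ r) = CBienergy.polar θ (CBienergy.profile t r)) ∧
        CBienergy.IsConformal (CBienergy.roundMetric m) (CBienergy.roundMetric m) (Φ t) ∧
        ContinuousMap.Homotopic (Φ t : C(CBienergy.Sph m, CBienergy.Sph m))
          (ContinuousMap.id (CBienergy.Sph m)) ∧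
        CBienergy.cBienergy (CBienergy.roundMetric m) (CBienergy.roundMetric m) (Φ t) =
          (1 / 2) * CBienergy.sphereVolume m *
            ∫ r in (0 : ℝ)..Real.pi, Real.sin (CBienergy.profile t r) ^ 2 *
              (((m : ℝ) - 2) ^ 2 * Real.sin r ^ (m - 5) *
                  (Real.cos (CBienergy.profile t r) - Real.cos r) ^ 2
                + (2 / 3) * (m : ℝ) * ((m : ℝ) - 1) * ((m : ℝ) - 3) * Real.sin r ^ (m - 3))) ∧
      Filter.Tendsto
        (fun t : ℝ ↦
          CBienergy.cBienergy (CBienergy.roundMetric m) (CBienergy.roundMetric m) (Φ t))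
        (𝓝[>] 0) (𝓝 0) := by
  -- The value for `t ≤ 0` is arbitrary: the claims concern positive `t` and the limit is from the
  -- right.
  let Φ : ℝ → C^∞⟮𝓡 m, CBienergy.Sph m; 𝓡 m, CBienergy.Sph m⟯ := fun t ↦
    if ht : 0 < t then CBienergy.dilation ht else CBienergy.dilation one_pos
  have hΦ {t : ℝ} (ht : 0 < t) : Φ t = CBienergy.dilation ht := dif_pos ht
  have hlim : Filter.Tendsto
      (fun t : ℝ ↦ CBienergy.cBienergy (CBienergy.roundMetric m) (CBienergy.roundMetric m) (Φ t))
      (𝓝[>] 0) (𝓝 0) := by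
    have h := (CBienergy.tendsto_integral_radialEnergyDensity m).const_mul
      ((1 / 2) * CBienergy.sphereVolume m)
    rw [mul_zero] at h
    refine h.congr' ?_
    filter_upwards [self_mem_nhdsWithin] with t ht
    rw [hΦ ht, CBienergy.cBienergy_dilation hm ht]
  refine ⟨fun ε hε ↦ ?_, Φ, fun t ht ↦ ?_, hlim⟩
  · obtain ⟨t, hlt, ht⟩ := ((hlim.eventually (gt_mem_nhds hε)).and self_mem_nhdsWithin).exists
    refine ⟨Φ t, ?_, hlt⟩
    rw [hΦ ht]
    exact CBienergy.dilation_homotopic ht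
  · rw [hΦ ht]
    exact ⟨fun θ r h0 h1 ↦ CBienergy.dilation_polar ht θ h0 h1, CBienergy.dilation_isConformal ht,
      CBienergy.dilation_homotopic ht, CBienergy.cBienergy_dilation hm ht⟩
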